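/- Hyperlogarithms. For a word $w=\sigma_1\cdots\sigma_n$ of complex letters put $L_{0^n}(z)=\frac{\log^n z}{n!}$ (so $L_1=1$ for the empty word) and otherwise $L_{\sigma w'}(z)=\int_0^z \frac{L_{w'}(z')}{z'-\sigma}\,dz'$, integrated along the straight segment, with $\log$ the principal branch. If $f(z)=\sum_{i=0}^n f_i(z)\log^i z$ for large $z\in(0,\infty)$ with all $f_i(1/z)$ holomorphic at $z=0$, put $\operatorname{Reg}_{z\to\infty}f(z)=f_0(\infty)$; if $F(t)=\sum_{i=0}^n F_i(t)\log^i t$ near $t=0$ with all $F_i$ holomorphic at $0$, put $\operatorname{Reg}_{t\to 0}F(t)=F_0(0)$. Let $\Sigma\subset\mathbb{Q}(t)$ be a finite set of rational functions that contains $0$ and contains no positive constant, let $T(\Sigma)$ be the $\mathbb{Q}$-vector space spanned by the words over $\Sigma$, and extend $w\mapsto L_w(z)$ linearly to $T(\Sigma)$. Let $\Sigma_t\subset\mathbb{C}$ be the set of all zeros and poles of the differences $\sigma-\rho$ of distinct $\sigma,\rho\in\Sigma$. Let $U$ be the plane cut along $(-\infty,0]$ and along the rays $\{r\tau: r\ge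 1\}$, $\tau\in\Sigma_t$, and let $D$ be the set of all $t\in U$ such that $\sigma(t)\notin(0,\infty)$ for all $\sigma\in\Sigma$. Then $\Sigma_t$ is a finite set of algebraic numbers, $D$ is open and dense in $\mathbb{C}$, and for all $w\in T(\Sigma)$ and $t\in D$ the regularized limit $R_w(t):=\operatorname{Reg}_{z\to\infty}L_w(z)$, the letters being evaluated at $t$, exists and is unique. Moreover, let $V\subseteq D$ be open, connected and non-empty. For every $w\in T(\Sigma)$, $R_w|_V$ has an analytic continuation to $U$ that has a regularized limit at $t\to0$ in $U$; write $\operatorname{Reg}_{t\to 0}R_w$ for this (uniquely determined) number, which may depend on $V$. And $R_w$ is on $V$ a hyperlogarithm in $t$ over the alphabet $\Sigma_t$ whose coefficients are such regularized limits: there is a finite sum $$R_w(t)=\sum_{u} c_u\,L_u(t)\qquad(t\in V)$$ over words $u$ in the letters $\Sigma_t$ in which every $c_u$ is of the form $c_u=\operatorname{Reg}_{t\to 0}R_v$ for some $v\in T(\Sigma)$. -/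

import Mathlib

open Filter Topology

noncomputable section

/-- The `ℚ`-vector space `T(A)` spanned by the words over the alphabet `A`. -/
abbrev WordSpace (A : Type*) : Type _ := List A →₀ ℚ

open Classical in
/-- The hyperlogarithm `L_w(z)` of a word `w` of complex letters, integrated along the straight
segment from `0` to `z` and with the principal logarithm: `L_{0^n}(z) = log(z)^n / n!`, and
otherwise `L_{σ w}(z) = ∫_0^z L_w(z') dz' / (z' - σ)`, where `z' = s z` with `0 < s < 1`. -/
def hyperlog : List ℂ → ℂ → ℂ
  | [], _ => 1
  | σ :: w, z =>
      if ∀ x ∈ σ :: w, x = 0 then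
        Complex.log z ^ (w.length + 1) / ((w.length + 1).factorial : ℂ)
      else
        ∫ s in (0 : ℝ)..1, z / ((s : ℂ) * z - σ) * hyperlog w ((s : ℂ) * z)

/-- The value `σ(t)` of a rational function `σ ∈ ℚ(t)` at a complex number `t`
(used only where `t` is not a pole of `σ`). -/
def letterAt (σ : RatFunc ℚ) (t : ℂ) : ℂ := RatFunc.eval (algebraMap ℚ ℂ) t σ

/-- `L_w(z)` for `w ∈ T(A)`, the letters in `A ⊆ ℚ(t)` being evaluated at `t`,
extended linearly from words to `T(A)`. -/
def hyperlogAt {A : Finset (RatFunc ℚ)} (w : WordSpace A) (t z : ℂ) : ℂ :=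
  w.sum fun v q => (q : ℂ) * hyperlog (v.map fun σ => letterAt σ.1 t) z

/-- `c` is the regularized limit of `f` at `z → ∞` along `(0, ∞)`: near infinity
`f(z) = ∑_{i ≤ n} f_i(z) log(z)^i` with all `f_i(1/z)` holomorphic at `z = 0`,
and `c = f_0(∞)`. Here `g i` stands for `f_i(1/z)`. -/
def HasRegLimInf (f : ℂ → ℂ) (c : ℂ) : Prop :=
  ∃ (n : ℕ) (g : ℕ → ℂ → ℂ), (∀ i, AnalyticAt ℂ (g i) 0) ∧ g 0 0 = c ∧
    ∀ᶠ x : ℝ in atTop,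
      f (x : ℂ) = ∑ i ∈ Finset.range (n + 1), g i ((x : ℂ)⁻¹) * Complex.log (x : ℂ) ^ i

open Classical in
/-- The regularized limit of `f` at `z → ∞` (`0` if there is none). -/
def regLimInf (f : ℂ → ℂ) : ℂ :=
  if h : ∃ c, HasRegLimInf f c then h.choose else 0

/-- `Reg_{z → ∞} L_w(z)` as a function of the parameter `t`. -/
def regHyperlog {A : Finset (RatFunc ℚ)} (w : WordSpace A) (t : ℂ) : ℂ :=
  regLimInf fun z => hyperlogAt w t z

/-- The set `Σ_t` of all zeros and poles in `ℂ` of the differences of distinct letters. -/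
def zeroPoleSet (A : Finset (RatFunc ℚ)) : Set ℂ :=
  {τ | ∃ σ ∈ A, ∃ ρ ∈ A, σ ≠ ρ ∧
    (Polynomial.aeval τ (σ - ρ).num = 0 ∨ Polynomial.aeval τ (σ - ρ).denom = 0)}

/-- The plane cut along `(-∞, 0]` and along the rays `[τ, τ ∞)` for `τ ∈ S`. -/
def cutPlane (S : Set ℂ) : Set ℂ :=
  {t | t ∈ Complex.slitPlane ∧ ∀ τ ∈ S, ∀ r : ℝ, 1 ≤ r → t ≠ (r : ℂ) * τ}

/-- The parameters `t` in the cut plane for which no letter takes a value in `(0, ∞)`. -/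
def paramDomain (A : Finset (RatFunc ℚ)) : Set ℂ :=
  {t | t ∈ cutPlane (zeroPoleSet A) ∧ ∀ σ ∈ A, ∀ x : ℝ, 0 < x → letterAt σ t ≠ (x : ℂ)}

/-- `c` is the regularized limit at `t → 0` in `U` of the analytic continuation `F` to `U` of the
function `f` on `V ⊆ U`: near `0` one has `F(t) = ∑_{i ≤ n} f_i(t) log(t)^i` with all
`f_i` holomorphic at `0`, and `c = f_0(0)`. -/
def HasRegLimZero (U V : Set ℂ) (f : ℂ → ℂ) (c : ℂ) : Prop :=
  ∃ F : ℂ → ℂ, DifferentiableOn ℂ F U ∧ Set.EqOn F f V ∧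
    ∃ (n : ℕ) (g : ℕ → ℂ → ℂ), (∀ i, AnalyticAt ℂ (g i) 0) ∧ g 0 0 = c ∧
      ∀ᶠ t in 𝓝[U] (0 : ℂ),
        F t = ∑ i ∈ Finset.range (n + 1), g i t * Complex.log t ^ i

end

/-!
The regularized limit at infinity is a continuous linear functional, so it commutes with
differentiation in the parameter `t`. To make this precise one solves the differential equations
of the hyperlogarithms in the Banach algebra of continuous functions on a closed disc around `t₀`
which are holomorphic inside: its elements serve as letters that depend on `t`, evaluation at a
point is a character and `d/dt` at `t₀` is a point derivation. All expansions in `log z` then hold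
in the algebra and may be pushed forward along both.

Differentiating `L_w(z)` in `t` and integrating by parts gives, up to a boundary term whose
regularized limits vanish, a sum over adjacent letters of logarithmic derivatives `∂ log (σ - ρ)`
times hyperlogarithms of words with one letter less. Since `∂ log (σ - ρ) = ∑ m_τ / (t - τ)` over
the zeros and poles `τ`, we have `∂R_w = ∑ R_{w_τ} / (t - τ)` with shorter `w_τ`. By induction on
the length `R_w` is a hyperlogarithm over `Σ_t`, the constants of integration being regularized
limits at `t → 0`, because every `L_u` with `u` non-empty has regularized limit `0` there.
-/

section LogExpansion

theorem nhdsWithin_slitPlane_zero_le : 𝓝[Complex.slitPlane] (0 : ℂ) ≤ 𝓝[≠] 0 :=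
  nhdsWithin_mono _ fun _ => Complex.slitPlane_ne_zero

variable {E : Type*} [NormedAddCommGroup E] [NormedSpace ℂ E]

/-- Near `0` in the slit plane `f` is a polynomial in `log z` whose coefficients `g i` are analytic
at `0`; `v i` is the value of `g i` at `0`. -/
def HasLogExpansion (f : ℂ → E) (v : ℕ → E) : Prop :=
  ∃ g : ℕ →₀ (ℂ → E), (∀ i, AnalyticAt ℂ (g i) 0) ∧ (∀ i, g i 0 = v i) ∧
    ∀ᶠ z in 𝓝[Complex.slitPlane] 0, f z = g.sum fun i h => Complex.log z ^ i • h z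

namespace HasLogExpansion

variable {f f' : ℂ → E} {v v' : ℕ → E}

theorem congr (h : HasLogExpansion f v) (hf : f' =ᶠ[𝓝[Complex.slitPlane] 0] f) :
    HasLogExpansion f' v := by
  obtain ⟨g, hg, hgv, hfg⟩ := h
  exact ⟨g, hg, hgv, hf.trans hfg⟩

theorem log_pow_smul {g : ℂ → E} (hg : AnalyticAt ℂ g 0) (k : ℕ) :
    HasLogExpansion (fun z => Complex.log z ^ k • g z) (Pi.single k (g 0)) := by
  refine ⟨Finsupp.single k g, fun i => ?_, fun i => ?_, Eventually.of_forall fun z => ?_⟩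
  · rw [Finsupp.single_apply]
    split_ifs
    exacts [hg, analyticAt_const]
  · rw [Finsupp.single_apply, Pi.single_apply]
    split_ifs with h₁ h₂ <;> first | rfl | omega
  · rw [Finsupp.sum_single_index (by simp)]

theorem of_analyticAt {g : ℂ → E} (hg : AnalyticAt ℂ g 0) :
    HasLogExpansion g (Pi.single 0 (g 0)) := by
  simpa using log_pow_smul hg 0

protected theorem zero : HasLogExpansion (fun _ => (0 : E)) 0 := by
  simpa using of_analyticAt (analyticAt_const (v := (0 : E)))

theorem add (h : HasLogExpansion f v) (h' : HasLogExpansion f' v') :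
    HasLogExpansion (fun z => f z + f' z) (v + v') := by
  obtain ⟨g, hg, hgv, hfg⟩ := h
  obtain ⟨g', hg', hgv', hfg'⟩ := h'
  refine ⟨g + g', fun i => (hg i).add (hg' i), fun i => by simp [hgv, hgv'], ?_⟩
  filter_upwards [hfg, hfg'] with z hz hz'
  rw [hz, hz', Finsupp.sum_add_index' (by simp) (by simp)]

theorem sum {ι : Type*} {f : ι → ℂ → E} {v : ι → ℕ → E} (s : Finset ι)
    (h : ∀ i ∈ s, HasLogExpansion (f i) (v i)) :
    HasLogExpansion (fun z => ∑ i ∈ s, f i z) (∑ i ∈ s, v i) := by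
  classical
  induction s using Finset.induction_on with
  | empty => simpa using HasLogExpansion.zero
  | insert a s ha ih =>
    simp only [Finset.sum_insert ha]
    exact (h a (by simp)).add (ih fun i hi => h i (by simp [hi]))

theorem map {F : Type*} [NormedAddCommGroup F] [NormedSpace ℂ F] (φ : E →L[ℂ] F)
    (h : HasLogExpansion f v) : HasLogExpansion (fun z => φ (f z)) (fun i => φ (v i)) := by
  obtain ⟨g, hg, hgv, hfg⟩ := h
  refine ⟨g.mapRange (fun h z => φ (h z)) (by ext; simp), fun i => ?_, fun i => by simp [hgv], ?_⟩
  · simpa using! (φ.analyticAt _).comp (hg i)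
  · filter_upwards [hfg] with z hz
    rw [hz, Finsupp.sum_mapRange_index (by simp), map_finsuppSum]
    simp

theorem const_smul (c : ℂ) (h : HasLogExpansion f v) :
    HasLogExpansion (fun z => c • f z) (c • v) :=
  h.map (c • ContinuousLinearMap.id ℂ E)

theorem sub (h : HasLogExpansion f v) (h' : HasLogExpansion f' v') :
    HasLogExpansion (fun z => f z - f' z) (v - v') := by
  simpa [sub_eq_add_neg] using h.add (h'.const_smul (-1))

theorem analytic_mul {A : Type*} [NormedRing A] [NormedAlgebra ℂ A] {f k : ℂ → A} {v : ℕ → A}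
    (hk : AnalyticAt ℂ k 0) (h : HasLogExpansion f v) :
    HasLogExpansion (fun z => k z * f z) (fun i => k 0 * v i) := by
  obtain ⟨g, hg, hgv, hfg⟩ := h
  refine ⟨g.mapRange (fun h z => k z * h z) (by ext; simp), fun i => ?_,
    fun i => by simp [hgv], ?_⟩
  · simpa using! hk.mul (hg i)
  · filter_upwards [hfg] with z hz
    rw [hz, Finsupp.sum_mapRange_index (by simp), Finsupp.mul_sum]
    simp

end HasLogExpansion

theorem exists_hasLogExpansion_iff {f : ℂ → ℂ} {c : ℂ} :
    (∃ v, HasLogExpansion f v ∧ v 0 = c) ↔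
      ∃ (n : ℕ) (g : ℕ → ℂ → ℂ), (∀ i, AnalyticAt ℂ (g i) 0) ∧ g 0 0 = c ∧
        ∀ᶠ z in 𝓝[Complex.slitPlane] 0,
          f z = ∑ i ∈ Finset.range (n + 1), g i z * Complex.log z ^ i := by
  constructor
  · rintro ⟨v, ⟨g, hg, hgv, hfg⟩, rfl⟩
    refine ⟨g.support.sup id, g, hg, hgv 0, hfg.mono fun z hz => ?_⟩
    rw [hz, Finsupp.sum_of_support_subset g (Finset.subset_range_sup_succ _) _ (by simp)]
    simp [mul_comm]
  · rintro ⟨n, g, hg, hgc, hfg⟩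
    refine ⟨_, (HasLogExpansion.sum (Finset.range (n + 1)) fun i _ =>
      .log_pow_smul (hg i) i).congr (hfg.mono fun z hz => by simp [hz, mul_comm]), ?_⟩
    rw [Finset.sum_apply, Finset.sum_eq_single 0] <;> simp +contextual [hgc]

section Primitive

theorem exists_analyticAt_primitive_inv_smul [CompleteSpace E] {g : ℂ → E}
    (hg : AnalyticAt ℂ g 0) (h0 : g 0 = 0) :
    ∃ H : ℂ → E, AnalyticAt ℂ H 0 ∧ H 0 = 0 ∧
      ∀ᶠ z in 𝓝[≠] 0, HasDerivAt H (z⁻¹ • g z) z := by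
  have hslope : AnalyticAt ℂ (dslope g 0) 0 := by
    obtain ⟨p, hp⟩ := hg
    exact ⟨_, hp.has_fpower_series_dslope_fslope⟩
  obtain ⟨r, hr, hball⟩ := Metric.eventually_nhds_iff_ball.1 hslope.eventually_analyticAt
  obtain ⟨H, hH0, hH⟩ := (DifferentiableOn.isExactOn_ball (c := (0 : ℂ)) (r := r)
    fun z hz => (hball z hz).differentiableAt.differentiableWithinAt).with_val_at 0 0
  refine ⟨H, ?_, hH0, ?_⟩
  · exact DifferentiableOn.analyticAt
      (fun z hz => (hH z hz).differentiableAt.differentiableWithinAt) (Metric.ball_mem_nhds _ hr)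
  · filter_upwards [nhdsWithin_le_nhds (Metric.ball_mem_nhds (0 : ℂ) hr), self_mem_nhdsWithin]
      with z hz hz0
    simpa [dslope_of_ne _ hz0, slope_def_module, h0] using hH z hz

/-- The values at `0` of the coefficients of the primitive of `z⁻¹ • f z` without constant term,
where `v` are those of `f`. -/
noncomputable def primitiveValues (v : ℕ → E) : ℕ → E
  | 0 => 0
  | i + 1 => ((i : ℂ) + 1)⁻¹ • v i

theorem hasDerivAt_log_pow_succ {z : ℂ} (hz : z ∈ Complex.slitPlane) (n : ℕ) :
    HasDerivAt (fun z => Complex.log z ^ (n + 1)) (z⁻¹ * ((n + 1) * Complex.log z ^ n)) z := by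
  convert! (Complex.hasDerivAt_log hz).pow (n + 1) using 1
  push_cast [Nat.add_sub_cancel]
  ring

theorem exists_primitive_log_pow_smul [CompleteSpace E] {g : ℂ → E} (hg : AnalyticAt ℂ g 0)
    (n : ℕ) :
    ∃ F : ℂ → E, HasLogExpansion F (Pi.single (n + 1) (((n : ℂ) + 1)⁻¹ • g 0)) ∧
      ∀ᶠ z in 𝓝[Complex.slitPlane] 0, HasDerivAt F (z⁻¹ • Complex.log z ^ n • g z) z := by
  induction n generalizing g with
  | zero =>
    obtain ⟨H, hH, hH0, hHd⟩ := exists_analyticAt_primitive_inv_smul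
      (hg.sub analyticAt_const) (sub_self (g 0))
    refine ⟨fun z => H z + Complex.log z ^ 1 • g 0, ?_, ?_⟩
    · simpa [hH0] using (HasLogExpansion.of_analyticAt hH).add
        (.log_pow_smul (analyticAt_const (v := g 0)) 1)
    · filter_upwards [nhdsWithin_slitPlane_zero_le hHd, self_mem_nhdsWithin] with z hHz hz
      convert! hHz.add ((hasDerivAt_log_pow_succ hz 0).smul_const (g 0)) using 1
      simp [smul_sub]
  | succ n ih =>
    obtain ⟨H, hH, hH0, hHd⟩ := exists_analyticAt_primitive_inv_smul
      (hg.sub analyticAt_const) (sub_self (g 0))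
    obtain ⟨G, hG, hGd⟩ := ih hH
    -- integration by parts: `log ^ (n + 1)` is differentiated, `H` is the integrated factor
    refine ⟨fun z => Complex.log z ^ (n + 1) • H z +
      Complex.log z ^ (n + 2) • ((n : ℂ) + 2)⁻¹ • g 0 - ((n : ℂ) + 1) • G z, ?_, ?_⟩
    · convert ((HasLogExpansion.log_pow_smul hH (n + 1)).add
        (.log_pow_smul analyticAt_const (n + 2))).sub (hG.const_smul ((n : ℂ) + 1)) using 1
      simp [hH0, add_assoc, one_add_one_eq_two]
    · filter_upwards [hGd, nhdsWithin_slitPlane_zero_le hHd, self_mem_nhdsWithin]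
        with z hGz hHz hz
      convert! (((hasDerivAt_log_pow_succ hz n).smul hHz).add
        ((hasDerivAt_log_pow_succ hz (n + 1)).smul_const (((n : ℂ) + 2)⁻¹ • g 0))).sub
        (hGz.const_smul ((n : ℂ) + 1)) using 1
      have hlead : ((n : ℂ) + 1 + 1) • ((n : ℂ) + 2)⁻¹ • g 0 = g 0 := by
        rw [add_assoc, one_add_one_eq_two, smul_inv_smul₀]
        exact_mod_cast (n + 1).succ_ne_zero
      simp only [Pi.sub_apply]
      push_cast
      linear_combination (norm := module) -(z⁻¹ * Complex.log z ^ (n + 1)) • hlead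

theorem HasLogExpansion.exists_primitive [CompleteSpace E] {f : ℂ → E} {v : ℕ → E}
    (h : HasLogExpansion f v) :
    ∃ F : ℂ → E, HasLogExpansion F (primitiveValues v) ∧
      ∀ᶠ z in 𝓝[Complex.slitPlane] 0, HasDerivAt F (z⁻¹ • f z) z := by
  obtain ⟨g, hg, hgv, hfg⟩ := h
  choose F hF hFd using fun i => exists_primitive_log_pow_smul (hg i) i
  refine ⟨fun z => ∑ i ∈ g.support, F i z, ?_, ?_⟩
  · convert HasLogExpansion.sum g.support fun i _ => hF i using 1
    funext j
    rcases j with _ | j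
    · simp [primitiveValues]
    · have hj : j ∉ g.support → v j = 0 := fun hj => by
        rw [← hgv, Finsupp.notMem_support_iff.1 hj, Pi.zero_apply]
      by_cases hjs : j ∈ g.support
      · simp [primitiveValues, hgv, Pi.single_apply, hjs]
      · simp [primitiveValues, hgv, Pi.single_apply, hjs, hj hjs]
  · filter_upwards [hfg, (Finset.eventually_all g.support).2 fun i _ => hFd i] with z hz hFz
    rw [hz, Finsupp.sum, Finset.smul_sum]
    exact HasDerivAt.fun_sum hFz

end Primitive

section Asymptotics

theorem complex_log_isBigO_log_norm :
    (fun z => Complex.log z) =O[𝓝[≠] 0] fun z => |Real.log ‖z‖| := by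
  have hone : ∀ᶠ z : ℂ in 𝓝[≠] 0, 1 ≤ |Real.log ‖z‖| :=
    ((tendsto_abs_atBot_atTop.comp Real.tendsto_log_nhdsGT_zero).comp
      tendsto_norm_nhdsNE_zero).eventually_ge_atTop 1
  refine Asymptotics.IsBigO.of_bound (1 + Real.pi) ?_
  filter_upwards [hone] with z hz
  calc ‖Complex.log z‖ ≤ |(Complex.log z).re| + |(Complex.log z).im| :=
        Complex.norm_le_abs_re_add_abs_im _
    _ ≤ |Real.log ‖z‖| + Real.pi := by
        rw [Complex.log_re, Complex.log_im]
        gcongr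
        exact Complex.abs_arg_le_pi z
    _ ≤ (1 + Real.pi) * ‖|Real.log ‖z‖|‖ := by
        rw [Real.norm_eq_abs, abs_abs]
        nlinarith [Real.pi_pos]

theorem complex_log_pow_isBigO_rpow {s : ℝ} (hs : s < 0) (k : ℕ) :
    (fun z => Complex.log z ^ k) =O[𝓝[≠] 0] fun z => ‖z‖ ^ s := by
  refine (complex_log_isBigO_log_norm.pow k).trans ?_
  have := ((isLittleO_abs_log_rpow_rpow_nhdsGT_zero (k : ℝ) hs).comp_tendsto
    (tendsto_norm_nhdsNE_zero (E := ℂ))).isBigO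
  simpa only [Function.comp_def, Real.rpow_natCast] using this

theorem HasLogExpansion.isBigO_sqrt {f : ℂ → E} (h : HasLogExpansion f 0) :
    f =O[𝓝[Complex.slitPlane] 0] fun z => ‖z‖ ^ (1 / 2 : ℝ) := by
  obtain ⟨g, hg, hg0, hfg⟩ := h
  refine EventuallyEq.trans_isBigO hfg (Asymptotics.IsBigO.fun_sum fun i _ => ?_)
  have hlin : g i =O[𝓝[≠] 0] fun z => ‖z‖ := by
    have := (hg i).differentiableAt.isBigO_sub
    simp only [hg0, Pi.zero_apply, sub_zero] at this
    exact (this.mono nhdsWithin_le_nhds).norm_right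
  refine (((complex_log_pow_isBigO_rpow (s := -(1 / 2)) (by norm_num) i).smul hlin).congr'
    .rfl ?_).mono nhdsWithin_slitPlane_zero_le
  filter_upwards [self_mem_nhdsWithin] with z hz
  rw [smul_eq_mul, ← Real.rpow_add_one (norm_ne_zero_iff.2 hz)]
  norm_num

theorem HasLogExpansion.tendsto_zero {f : ℂ → E} (h : HasLogExpansion f 0) :
    Tendsto f (𝓝[Complex.slitPlane] 0) (𝓝 0) := by
  refine h.isBigO_sqrt.trans_tendsto (Tendsto.mono_left ?_ nhdsWithin_le_nhds)
  have : Continuous fun z : ℂ => ‖z‖ ^ (1 / 2 : ℝ) :=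
    continuous_norm.rpow_const fun _ => Or.inr (by norm_num)
  simpa using this.tendsto 0

end Asymptotics

section Uniqueness

theorem tendsto_ofReal_nhdsGT_nhdsWithin_slitPlane :
    Tendsto (fun x : ℝ => (x : ℂ)) (𝓝[>] 0) (𝓝[Complex.slitPlane] 0) :=
  tendsto_nhdsWithin_iff.2 ⟨(Complex.continuous_ofReal.tendsto' 0 0 rfl).mono_left
    nhdsWithin_le_nhds, eventually_mem_nhdsWithin.mono fun _ => Complex.ofReal_mem_slitPlane.2⟩

theorem tendsto_norm_log_ofReal_nhdsGT :
    Tendsto (fun x : ℝ => ‖Complex.log x‖) (𝓝[>] 0) atTop := by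
  refine (tendsto_abs_atBot_atTop.comp Real.tendsto_log_nhdsGT_zero).congr' ?_
  filter_upwards [self_mem_nhdsWithin] with x hx
  rw [← Complex.ofReal_log (le_of_lt hx), Complex.norm_real]
  rfl

theorem polynomial_eq_zero_of_tendsto_eval {α : Type*} {l : Filter α} [l.NeBot]
    {p : Polynomial ℂ} {u : α → ℂ} (hu : Tendsto (fun x => ‖u x‖) l atTop)
    (hp : Tendsto (fun x => p.eval (u x)) l (𝓝 0)) : p = 0 := by
  have hdeg : ¬ 0 < p.degree := fun hdeg =>
    not_tendsto_nhds_of_tendsto_atTop (p.tendsto_norm_atTop hdeg hu) _ hp.norm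
  have hC := Polynomial.eq_C_of_degree_le_zero (not_lt.1 hdeg)
  rw [hC] at hp ⊢
  simp only [Polynomial.eval_C] at hp
  rw [tendsto_nhds_unique tendsto_const_nhds hp, map_zero]

theorem HasLogExpansion.values_eq_zero_of_complex {f : ℂ → ℂ} {v : ℕ → ℂ}
    (h : HasLogExpansion f v) (hf : ∀ᶠ x : ℝ in 𝓝[>] 0, f x = 0) : v = 0 := by
  obtain ⟨g, hg, hgv, hfg⟩ := h
  set p : Polynomial ℂ := ∑ i ∈ g.support, Polynomial.monomial i (v i)
  have hrest : HasLogExpansion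
      (fun z => ∑ i ∈ g.support, Complex.log z ^ i • (g i z - v i)) 0 := by
    have := HasLogExpansion.sum g.support fun i _ =>
      HasLogExpansion.log_pow_smul ((hg i).fun_sub (analyticAt_const (v := v i))) i
    simpa [hgv] using this
  have hp : p = 0 := by
    refine polynomial_eq_zero_of_tendsto_eval tendsto_norm_log_ofReal_nhdsGT ?_
    rw [← neg_zero (G := ℂ)]
    refine (hrest.tendsto_zero.comp tendsto_ofReal_nhdsGT_nhdsWithin_slitPlane).neg.congr' ?_
    filter_upwards [hf, tendsto_ofReal_nhdsGT_nhdsWithin_slitPlane.eventually hfg] with x hx hgx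
    rw [hx] at hgx
    simp only [Function.comp_apply, smul_sub, Finset.sum_sub_distrib]
    rw [show ∑ i ∈ g.support, Complex.log x ^ i • g i x = 0 from hgx.symm]
    simp [p, Polynomial.eval_finsetSum, mul_comm]
  funext i
  have hcoeff : p.coeff i = v i := by
    simp only [p, Polynomial.finsetSum_coeff, Polynomial.coeff_monomial, Finset.sum_ite_eq']
    split_ifs with hi
    · rfl
    · rw [← hgv, Finsupp.notMem_support_iff.1 hi, Pi.zero_apply]
  rw [← hcoeff, hp, Polynomial.coeff_zero, Pi.zero_apply]

theorem HasLogExpansion.values_unique {f f' : ℂ → E} {v v' : ℕ → E} (h : HasLogExpansion f v)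
    (h' : HasLogExpansion f' v') (hf : ∀ᶠ x : ℝ in 𝓝[>] 0, f x = f' x) : v = v' := by
  funext i
  refine sub_eq_zero.1 ((SeparatingDual.eq_zero_iff_forall_dual_eq_zero (R := ℂ) _).2 fun φ => ?_)
  exact congrFun (((h.sub h').map φ).values_eq_zero_of_complex
    (hf.mono fun x hx => by simp [hx])) i

end Uniqueness

section RegLim

/-- `r` is the regularized limit of `f` at `0` along the positive reals: the value at `0` of the
coefficient of `log x ^ 0` in a logarithmic expansion of `f`. -/
def HasRegLim (f : ℝ → E) (r : E) : Prop :=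
  ∃ (φ : ℂ → E) (v : ℕ → E), HasLogExpansion φ v ∧ v 0 = r ∧ ∀ᶠ x : ℝ in 𝓝[>] 0, f x = φ x

theorem HasLogExpansion.hasRegLim {f : ℂ → E} {v : ℕ → E} (h : HasLogExpansion f v) :
    HasRegLim (fun x : ℝ => f x) (v 0) :=
  ⟨f, v, h, rfl, Eventually.of_forall fun _ => rfl⟩

theorem hasRegLim_iff_exists {f : ℝ → ℂ} {r : ℂ} :
    HasRegLim f r ↔ ∃ (n : ℕ) (g : ℕ → ℂ → ℂ), (∀ i, AnalyticAt ℂ (g i) 0) ∧ g 0 0 = r ∧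
      ∀ᶠ x : ℝ in 𝓝[>] 0, f x = ∑ i ∈ Finset.range (n + 1), g i x * Complex.log x ^ i := by
  constructor
  · rintro ⟨φ, v, hφ, hv, hf⟩
    obtain ⟨n, g, hg, hgr, hφg⟩ := exists_hasLogExpansion_iff.1 ⟨v, hφ, hv⟩
    refine ⟨n, g, hg, hgr, ?_⟩
    filter_upwards [hf, tendsto_ofReal_nhdsGT_nhdsWithin_slitPlane.eventually hφg] with x hx hgx
    rw [hx, hgx]
  · rintro ⟨n, g, hg, hgr, hf⟩
    obtain ⟨v, hφ, hv⟩ := exists_hasLogExpansion_iff.2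
      ⟨n, g, hg, hgr, Eventually.of_forall fun z => rfl⟩
    exact ⟨_, v, hφ, hv, hf⟩

namespace HasRegLim

variable {f f' : ℝ → E} {r r' : E}

theorem congr (h : HasRegLim f r) (hf : f' =ᶠ[𝓝[>] 0] f) : HasRegLim f' r := by
  obtain ⟨φ, v, hφ, hv, hfφ⟩ := h
  exact ⟨φ, v, hφ, hv, hf.trans hfφ⟩

protected theorem const (c : E) : HasRegLim (fun _ => c) c := by
  simpa using (HasLogExpansion.of_analyticAt (analyticAt_const (v := c))).hasRegLim

theorem unique (h : HasRegLim f r) (h' : HasRegLim f r') : r = r' := by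
  obtain ⟨φ, v, hφ, rfl, hfφ⟩ := h
  obtain ⟨φ', v', hφ', rfl, hfφ'⟩ := h'
  rw [hφ.values_unique hφ' (by filter_upwards [hfφ, hfφ'] with x h₁ h₂ using h₁.symm.trans h₂)]

theorem sub (h : HasRegLim f r) (h' : HasRegLim f' r') :
    HasRegLim (fun x => f x - f' x) (r - r') := by
  obtain ⟨φ, v, hφ, rfl, hfφ⟩ := h
  obtain ⟨φ', v', hφ', rfl, hfφ'⟩ := h'
  exact ⟨_, _, hφ.sub hφ', rfl, by filter_upwards [hfφ, hfφ'] with x h₁ h₂ using by rw [h₁, h₂]⟩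

theorem map {F : Type*} [NormedAddCommGroup F] [NormedSpace ℂ F] (φ : E →L[ℂ] F)
    (h : HasRegLim f r) : HasRegLim (fun x => φ (f x)) (φ r) := by
  obtain ⟨ψ, v, hψ, rfl, hfψ⟩ := h
  exact ⟨_, _, hψ.map φ, rfl, hfψ.mono fun x hx => congrArg φ hx⟩

theorem sum {ι : Type*} {f : ι → ℝ → E} {r : ι → E} (s : Finset ι)
    (h : ∀ i ∈ s, HasRegLim (f i) (r i)) : HasRegLim (fun x => ∑ i ∈ s, f i x) (∑ i ∈ s, r i) := by
  choose! φ v hφ hv hf using h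
  refine ⟨_, _, HasLogExpansion.sum s hφ, ?_, ?_⟩
  · rw [Finset.sum_apply]
    exact Finset.sum_congr rfl hv
  · filter_upwards [(Finset.eventually_all s).2 hf] with x hx using Finset.sum_congr rfl hx

theorem analytic_mul {A : Type*} [NormedRing A] [NormedAlgebra ℂ A] {f : ℝ → A} {k : ℂ → A}
    {r : A} (hk : AnalyticAt ℂ k 0) (h : HasRegLim f r) :
    HasRegLim (fun x => k x * f x) (k 0 * r) := by
  obtain ⟨φ, v, hφ, rfl, hfφ⟩ := h
  exact ⟨_, _, hφ.analytic_mul hk, rfl, hfφ.mono fun x hx => congrArg (k x * ·) hx⟩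

end HasRegLim

theorem HasRegLim.exists_of_hasDerivAt [CompleteSpace E] {f F : ℝ → E} {r : E}
    (h : HasRegLim f r) (hF : ∀ᶠ x : ℝ in 𝓝[>] 0, HasDerivAt F ((x⁻¹ : ℂ) • f x) x) :
    ∃ c, HasRegLim F c := by
  obtain ⟨φ, v, hφ, -, hfφ⟩ := h
  obtain ⟨Φ, hΦ, hΦd⟩ := hφ.exists_primitive
  have hderiv : ∀ᶠ x : ℝ in 𝓝[>] 0, HasDerivAt (fun x : ℝ => F x - Φ x) 0 x := by
    filter_upwards [hF, hfφ, tendsto_ofReal_nhdsGT_nhdsWithin_slitPlane.eventually hΦd]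
      with x hFx hx hΦx
    simpa [hx] using! hFx.sub (hΦx.scomp x Complex.ofRealCLM.hasDerivAt)
  obtain ⟨ε, hε, hsub⟩ := mem_nhdsGT_iff_exists_Ioo_subset.1 hderiv
  obtain ⟨c, hc⟩ := isOpen_Ioo.exists_is_const_of_deriv_eq_zero isPreconnected_Ioo
    (fun x hx => (hsub hx).differentiableAt.differentiableWithinAt) fun x hx => (hsub hx).deriv
  refine ⟨_, _, _, hΦ.add (.of_analyticAt (analyticAt_const (v := c))), rfl, ?_⟩
  filter_upwards [Ioo_mem_nhdsGT hε] with x hx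
  rw [← hc x hx, add_sub_cancel]

theorem eqOn_Ioi_of_hasDerivAt_of_hasRegLim {f f' k : ℝ → E} {r : E}
    (hf : ∀ x, 0 < x → HasDerivAt f (k x) x) (hf' : ∀ x, 0 < x → HasDerivAt f' (k x) x)
    (hr : HasRegLim f r) (hr' : HasRegLim f' r) : Set.EqOn f f' (Set.Ioi 0) := by
  have hderiv : ∀ x ∈ Set.Ioi (0 : ℝ), HasDerivAt (fun x => f x - f' x) 0 x := fun x hx => by
    simpa using (hf x hx).fun_sub (hf' x hx)
  obtain ⟨c, hc⟩ := isOpen_Ioi.exists_is_const_of_deriv_eq_zero isPreconnected_Ioi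
    (fun x hx => (hderiv x hx).differentiableAt.differentiableWithinAt)
    fun x hx => (hderiv x hx).deriv
  have hc0 : c = 0 := by
    rw [← sub_self r]
    exact ((HasRegLim.const c).congr (eventually_mem_nhdsWithin.mono hc)).unique (hr.sub hr')
  exact fun x hx => sub_eq_zero.1 ((hc x hx).trans hc0)

theorem eventually_atTop_iff_eventually_inv_nhdsGT_zero {p : ℝ → Prop} :
    (∀ᶠ x in atTop, p x) ↔ ∀ᶠ y in 𝓝[>] 0, p y⁻¹ := by
  rw [← inv_nhdsGT_zero]
  rfl

theorem complex_log_ofReal_inv {y : ℝ} (hy : 0 < y) :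
    Complex.log (y : ℂ)⁻¹ = -Complex.log y :=
  Complex.log_inv _ (Complex.slitPlane_arg_ne_pi (Complex.ofReal_mem_slitPlane.2 hy))

theorem hasRegLimInf_iff {f : ℂ → ℂ} {c : ℂ} :
    HasRegLimInf f c ↔ HasRegLim (fun y : ℝ => f (y : ℂ)⁻¹) c := by
  have hneg (a L : ℂ) (i : ℕ) : a * (-L) ^ i = (-1) ^ i * a * L ^ i := by
    rw [neg_pow]
    ring
  rw [hasRegLim_iff_exists]
  simp only [HasRegLimInf, eventually_atTop_iff_eventually_inv_nhdsGT_zero, Complex.ofReal_inv,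
    inv_inv]
  constructor
  · rintro ⟨n, g, hg, hgc, hf⟩
    refine ⟨n, fun i z => (-1) ^ i * g i z, fun i => analyticAt_const.mul (hg i), by simp [hgc], ?_⟩
    filter_upwards [hf, self_mem_nhdsWithin] with y hy hy0
    simp only [hy, complex_log_ofReal_inv hy0, hneg]
  · rintro ⟨n, g, hg, hgc, hf⟩
    refine ⟨n, fun i z => (-1) ^ i * g i z, fun i => analyticAt_const.mul (hg i), by simp [hgc], ?_⟩
    filter_upwards [hf, self_mem_nhdsWithin] with y hy hy0
    simp only [hy, complex_log_ofReal_inv hy0, ← hneg, neg_neg]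

theorem HasRegLimInf.unique {f : ℂ → ℂ} {c c' : ℂ} (h : HasRegLimInf f c)
    (h' : HasRegLimInf f c') : c = c' :=
  (hasRegLimInf_iff.1 h).unique (hasRegLimInf_iff.1 h')

theorem HasRegLimInf.regLimInf_eq {f : ℂ → ℂ} {c : ℂ} (h : HasRegLimInf f c) :
    regLimInf f = c := by
  have hex : ∃ c, HasRegLimInf f c := ⟨c, h⟩
  rw [regLimInf, dif_pos hex]
  exact hex.choose_spec.unique h

end RegLim

end LogExpansion

section CutPlane

variable {S : Set ℂ} {z : ℂ}

theorem real_mul_mem_slitPlane (hz : z ∈ Complex.slitPlane) {s : ℝ} (hs : 0 < s) :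
    (s : ℂ) * z ∈ Complex.slitPlane := by
  rw [Complex.mem_slitPlane_iff] at hz ⊢
  rw [Complex.re_ofReal_mul, Complex.im_ofReal_mul]
  exact hz.imp (mul_pos hs) (mul_ne_zero hs.ne')

theorem real_mul_mem_cutPlane (hz : z ∈ cutPlane S) {s : ℝ} (hs : 0 < s) (hs1 : s ≤ 1) :
    (s : ℂ) * z ∈ cutPlane S := by
  refine ⟨real_mul_mem_slitPlane hz.1 hs, fun τ hτ r hr h => hz.2 τ hτ (r / s) ?_ ?_⟩
  · rw [le_div_iff₀ hs]
    linarith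
  · have : (s : ℂ) ≠ 0 := by exact_mod_cast hs.ne'
    push_cast
    field_simp
    rw [mul_comm]
    exact h

theorem ne_of_mem_cutPlane (hz : z ∈ cutPlane S) {τ : ℂ} (hτ : τ ∈ S) : z ≠ τ := by
  simpa using hz.2 τ hτ 1 le_rfl

theorem ofReal_mem_cutPlane (hS : ∀ τ ∈ S, ∀ x : ℝ, 0 < x → τ ≠ x) {x : ℝ} (hx : 0 < x) :
    (x : ℂ) ∈ cutPlane S := by
  refine ⟨Complex.ofReal_mem_slitPlane.2 hx, fun τ hτ r hr h => hS τ hτ (x / r) (by positivity) ?_⟩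
  have : (r : ℂ) ≠ 0 := by exact_mod_cast (by linarith : r ≠ 0)
  push_cast
  rw [h]
  field_simp

theorem isOpen_cutPlane (hS : S.Finite) : IsOpen (cutPlane S) := by
  have : cutPlane S = Complex.slitPlane ∩
      ⋂ τ ∈ S, ((fun r : ℝ => r • τ) '' Set.Ici 1)ᶜ := by
    ext z
    simp only [cutPlane, Set.mem_ofPred_eq, Set.mem_inter_iff, Set.mem_iInter, Set.mem_compl_iff,
      Set.mem_image, Set.mem_Ici, not_exists, not_and, Complex.real_smul]
    exact and_congr_right fun _ => forall₂_congr fun _ _ => forall₂_congr fun _ _ => ne_comm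
  rw [this]
  exact Complex.isOpen_slitPlane.inter (hS.isOpen_biInter fun τ _ =>
    (isClosedMap_smul_left τ _ isClosed_Ici).isOpen_compl)

theorem eventually_mem_cutPlane (hS : S.Finite) :
    ∀ᶠ z in 𝓝[Complex.slitPlane] 0, z ∈ cutPlane S := by
  have hsmall : ∀ᶠ z : ℂ in 𝓝 0, ∀ τ ∈ S, τ ≠ 0 → ‖z‖ < ‖τ‖ := by
    refine (eventually_all_finite hS).2 fun τ _ => ?_
    by_cases h : τ = 0
    · simp [h]
    · filter_upwards [Metric.ball_mem_nhds (0 : ℂ) (norm_pos_iff.2 h)] with z hz _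
      simpa using hz
  filter_upwards [nhdsWithin_le_nhds hsmall, self_mem_nhdsWithin] with z hz hz'
  refine ⟨hz', fun τ hτ r hr h => ?_⟩
  have h0 : τ ≠ 0 := by
    rintro rfl
    exact Complex.slitPlane_ne_zero hz' (by simp [h])
  have := hz τ hτ h0
  rw [h, norm_mul, Complex.norm_real, Real.norm_eq_abs, abs_of_pos (by linarith)] at this
  nlinarith [norm_pos_iff.2 h0]

theorem eventually_slitPlane_ray {p : ℂ → Prop} (h : ∀ᶠ z in 𝓝[Complex.slitPlane] 0, p z) :
    ∀ᶠ z in 𝓝[Complex.slitPlane] 0, ∀ s : ℝ, 0 < s → s ≤ 1 → p (s * z) := by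
  obtain ⟨r, hr, hp⟩ := Metric.nhdsWithin_basis_ball.eventually_iff.1 h
  refine Metric.nhdsWithin_basis_ball.eventually_iff.2 ⟨r, hr, fun z hz s hs hs1 => hp ⟨?_, ?_⟩⟩
  · have := hz.1
    rw [mem_ball_zero_iff] at this ⊢
    rw [norm_mul, Complex.norm_real, Real.norm_eq_abs, abs_of_pos hs]
    nlinarith [norm_nonneg z]
  · exact real_mul_mem_slitPlane hz.2 hs

theorem tendsto_real_mul_slitPlane (hz : z ∈ Complex.slitPlane) :
    Tendsto (fun s : ℝ => (s : ℂ) * z) (𝓝[>] 0) (𝓝[Complex.slitPlane] 0) := by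
  refine tendsto_nhdsWithin_iff.2 ⟨?_, eventually_mem_nhdsWithin.mono fun s hs =>
    real_mul_mem_slitPlane hz hs⟩
  have : Continuous fun s : ℝ => (s : ℂ) * z := by fun_prop
  simpa using (this.tendsto 0).mono_left nhdsWithin_le_nhds

end CutPlane

section RayIntegral

open MeasureTheory (volume)

/-- The integral of `f` along the straight segment from `0` to `z`. -/
noncomputable def rayIntegral (f : ℂ → ℂ) (z : ℂ) : ℂ :=
  ∫ s in (0 : ℝ)..1, z * f (s * z)

theorem intervalIntegrable_of_isBigO_rpow {E : Type*} [NormedAddCommGroup E] {f : ℝ → E}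
    {b p : ℝ} (hb : 0 < b) (hp : -1 < p) (hf : ContinuousOn f (Set.Ioc 0 b))
    (hO : f =O[𝓝[>] 0] fun s => s ^ p) : IntervalIntegrable f volume 0 b := by
  have hpow : MeasureTheory.IntegrableAtFilter (fun s : ℝ => s ^ p) (𝓝[>] 0) :=
    ⟨Set.Ioc 0 b, Ioc_mem_nhdsGT hb, (intervalIntegrable_iff_integrableOn_Ioc_of_le hb.le).1
      (intervalIntegral.intervalIntegrable_rpow' hp)⟩
  have hmeas : StronglyMeasurableAtFilter f (𝓝[>] 0) :=
    ⟨Set.Ioc 0 b, Ioc_mem_nhdsGT hb, hf.aestronglyMeasurable measurableSet_Ioc⟩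
  obtain ⟨s, hs, hfs⟩ := hO.integrableAtFilter hmeas hpow
  obtain ⟨c, hc, hcs⟩ := (mem_nhdsGT_iff_exists_mem_Ioc_Ioo_subset hb).1 hs
  refine IntervalIntegrable.trans (b := c) ?_ ?_
  · exact (intervalIntegrable_iff_integrableOn_Ioo_of_le hc.1.le).2 (hfs.mono_set hcs)
  · refine ContinuousOn.intervalIntegrable (hf.mono ?_)
    rw [Set.uIcc_of_le hc.2]
    exact fun s hs => ⟨hc.1.trans_le hs.1, hs.2⟩

theorem hasDerivAt_comp_real_mul {G : ℂ → ℂ} {z c : ℂ} {s : ℝ} (h : HasDerivAt G c (s * z)) :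
    HasDerivAt (fun s : ℝ => G (s * z)) (z * c) s := by
  rw [mul_comm]
  exact h.comp s (by simpa using (Complex.ofRealCLM.hasDerivAt (x := s)).mul_const z)

theorem rayIntegral_eq_of_hasDerivAt {f G : ℂ → ℂ} {z : ℂ} (hz : z ∈ Complex.slitPlane)
    (hG : ∀ s : ℝ, 0 < s → s ≤ 1 → HasDerivAt G (f (s * z)) (s * z))
    (hint : IntervalIntegrable (fun s : ℝ => z * f (s * z)) volume 0 1)
    (hG0 : Tendsto G (𝓝[Complex.slitPlane] 0) (𝓝 0)) : rayIntegral f z = G z := by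
  have hGs : ∀ s : ℝ, 0 < s → s ≤ 1 → HasDerivAt (fun s : ℝ => G (s * z)) (z * f (s * z)) s :=
    fun s hs hs1 => hasDerivAt_comp_real_mul (hG s hs hs1)
  have := intervalIntegral.integral_eq_sub_of_hasDerivAt_of_tendsto one_pos
    (fun s hs => hGs s hs.1 hs.2.le) hint (hG0.comp (tendsto_real_mul_slitPlane hz))
    ((hGs 1 one_pos le_rfl).continuousAt.tendsto.mono_left nhdsWithin_le_nhds)
  simpa [rayIntegral] using this

theorem rayIntegral_eq_rayIntegral_mul_add {f : ℂ → ℂ} {z : ℂ} {ε : ℝ} (hε : ε ∈ Set.Icc 0 1)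
    (hint : IntervalIntegrable (fun s : ℝ => z * f (s * z)) volume 0 1) :
    rayIntegral f z = rayIntegral f (ε * z) + ∫ s in ε..1, z * f (s * z) := by
  have hε' : ε ∈ Set.uIcc 0 1 := by rwa [Set.uIcc_of_le zero_le_one]
  rw [rayIntegral, ← intervalIntegral.integral_add_adjacent_intervals
    (hint.mono_set (Set.uIcc_subset_uIcc_left hε'))
    (hint.mono_set (Set.uIcc_subset_uIcc_right hε'))]
  have := intervalIntegral.smul_integral_comp_mul_left (a := 0) (b := 1)
    (fun s : ℝ => z * f (s * z)) ε
  rw [mul_zero, mul_one] at this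
  rw [← this, rayIntegral, ← intervalIntegral.integral_smul]
  simp only [Complex.ofReal_mul, Complex.real_smul, mul_assoc, mul_left_comm (ε : ℂ)]

theorem exists_convex_open_segment {E : Type*} [NormedAddCommGroup E] [NormedSpace ℝ E]
    {U : Set E} (hU : IsOpen U) {a b : E} (hab : segment ℝ a b ⊆ U) :
    ∃ N, IsOpen N ∧ Convex ℝ N ∧ segment ℝ a b ⊆ N ∧ N ⊆ U := by
  have hc : IsCompact (segment ℝ a b) := by
    rw [segment_eq_image_lineMap]
    exact isCompact_Icc.image AffineMap.lineMap_continuous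
  obtain ⟨δ, hδ, hsub⟩ := hc.exists_thickening_subset_open hU hab
  exact ⟨_, Metric.isOpen_thickening, (convex_segment a b).thickening δ,
    Metric.self_subset_thickening hδ _, hsub⟩

theorem segment_real_mul {ε : ℝ} (hε : ε ≤ 1) (z : ℂ) :
    segment ℝ ((ε : ℂ) * z) z = (fun s : ℝ => (s : ℂ) * z) '' Set.Icc ε 1 := by
  have := image_segment ℝ (LinearMap.toSpanSingleton ℝ ℂ z).toAffineMap ε 1
  simpa [segment_eq_Icc hε] using this.symm

theorem exists_eventually_integral_ray_eq_sub {U : Set ℂ} (hU : IsOpen U) {f : ℂ → ℂ}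
    (hf : DifferentiableOn ℂ f U) {ε : ℝ} (hε : ε ≤ 1) {z : ℂ}
    (hzU : ∀ s ∈ Set.Icc ε 1, (s : ℂ) * z ∈ U) :
    ∃ H : ℂ → ℂ, HasDerivAt H (f (ε * z)) (ε * z) ∧ HasDerivAt H (f z) z ∧
      ∀ᶠ u in 𝓝 z, ∫ s in ε..1, u * f (s * u) = H u - H (ε * u) := by
  obtain ⟨N, hNo, hNc, hsN, hNU⟩ := exists_convex_open_segment hU (a := (ε : ℂ) * z) (b := z)
    (by rw [segment_real_mul hε]; exact Set.image_subset_iff.2 hzU)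
  obtain ⟨H, hH⟩ := hNc.exists_forall_hasDerivWithinAt (hf.mono hNU)
  have hHd : ∀ u ∈ N, HasDerivAt H (f u) u := fun u hu => (hH u hu).hasDerivAt (hNo.mem_nhds hu)
  have hzN : z ∈ N := hsN (right_mem_segment ℝ _ _)
  have hεzN : (ε : ℂ) * z ∈ N := hsN (left_mem_segment ℝ _ _)
  have hmul : Continuous fun u : ℂ => (ε : ℂ) * u := by fun_prop
  refine ⟨H, hHd _ hεzN, hHd _ hzN, ?_⟩
  filter_upwards [hNo.mem_nhds hzN, hmul.continuousAt.preimage_mem_nhds (hNo.mem_nhds hεzN)]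
    with u huN hεuN
  have hsu : ∀ s ∈ Set.uIcc ε 1, (s : ℂ) * u ∈ N := by
    rw [Set.uIcc_of_le hε]
    exact Set.image_subset_iff.1 (segment_real_mul hε u ▸ hNc.segment_subset hεuN huN)
  have hcont : ContinuousOn (fun s : ℝ => u * f (s * u)) (Set.uIcc ε 1) :=
    continuousOn_const.mul ((hf.mono hNU).continuousOn.comp (by fun_prop) hsu)
  simpa using intervalIntegral.integral_eq_sub_of_hasDerivAt
    (fun s hs => hasDerivAt_comp_real_mul (hHd _ (hsu s hs))) hcont.intervalIntegrable

variable {S : Set ℂ} {f : ℂ → ℂ}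

theorem intervalIntegrable_ray (hf : ContinuousOn f (cutPlane S))
    (h0 : HasLogExpansion (fun z => z * f z) 0) {z : ℂ} (hz : z ∈ cutPlane S) :
    IntervalIntegrable (fun s : ℝ => z * f (s * z)) volume 0 1 := by
  refine intervalIntegrable_of_isBigO_rpow (p := -1 + 1 / 2) one_pos (by norm_num) ?_ ?_
  · exact continuousOn_const.mul (hf.comp (by fun_prop) fun s hs =>
      real_mul_mem_cutPlane hz hs.1 hs.2)
  · have hsqrt : (fun s : ℝ => s * z * f (s * z)) =O[𝓝[>] 0] fun s => s ^ (1 / 2 : ℝ) := by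
      refine (h0.isBigO_sqrt.comp_tendsto (tendsto_real_mul_slitPlane hz.1)).trans
        (.of_bound (‖z‖ ^ (1 / 2 : ℝ)) ?_)
      filter_upwards [self_mem_nhdsWithin] with s (hs : 0 < s)
      simp only [Function.comp_apply, norm_mul, Complex.norm_real]
      rw [Real.mul_rpow (norm_nonneg s) (norm_nonneg z),
        Real.norm_of_nonneg hs.le, Real.norm_of_nonneg (by positivity),
        Real.norm_of_nonneg (by positivity), mul_comm]
    have hinv : (fun s : ℝ => (s : ℂ)⁻¹) =O[𝓝[>] 0] fun s => s ^ (-1 : ℝ) :=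
      .of_bound 1 (.of_forall fun s => by simp [Real.rpow_neg_one])
    refine (hinv.mul hsqrt).congr' ?_ ?_
    · filter_upwards [self_mem_nhdsWithin] with s (hs : 0 < s)
      have : (s : ℂ) ≠ 0 := by exact_mod_cast hs.ne'
      field_simp
    · filter_upwards [self_mem_nhdsWithin] with s (hs : 0 < s)
      exact (Real.rpow_add hs _ _).symm

theorem exists_rayIntegral_eventuallyEq (hS : S.Finite) (hf : ContinuousOn f (cutPlane S))
    (h0 : HasLogExpansion (fun z => z * f z) 0) : ∃ G, HasLogExpansion G 0 ∧
      ∀ᶠ z in 𝓝[Complex.slitPlane] 0, rayIntegral f z = G z ∧ HasDerivAt G (f z) z := by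
  obtain ⟨G, hG, hGd⟩ := h0.exists_primitive
  have hvalues : primitiveValues (0 : ℕ → ℂ) = 0 := by
    funext i
    cases i <;> simp [primitiveValues]
  rw [hvalues] at hG
  have hGf : ∀ᶠ z in 𝓝[Complex.slitPlane] 0, HasDerivAt G (f z) z := by
    filter_upwards [hGd, self_mem_nhdsWithin] with z hz hz0
    simpa [Complex.slitPlane_ne_zero hz0] using hz
  refine ⟨G, hG, ?_⟩
  filter_upwards [hGf, eventually_slitPlane_ray hGf, eventually_mem_cutPlane hS] with z hz hray hzS
  exact ⟨rayIntegral_eq_of_hasDerivAt hzS.1 hray (intervalIntegrable_ray hf h0 hzS)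
    hG.tendsto_zero, hz⟩

theorem hasLogExpansion_rayIntegral (hS : S.Finite) (hf : ContinuousOn f (cutPlane S))
    (h0 : HasLogExpansion (fun z => z * f z) 0) : HasLogExpansion (rayIntegral f) 0 := by
  obtain ⟨G, hG, hfG⟩ := exists_rayIntegral_eventuallyEq hS hf h0
  exact hG.congr (hfG.mono fun z hz => hz.1)

theorem eventually_hasDerivAt_rayIntegral (hS : S.Finite) (hf : ContinuousOn f (cutPlane S))
    (h0 : HasLogExpansion (fun z => z * f z) 0) :
    ∀ᶠ z in 𝓝[Complex.slitPlane] 0, HasDerivAt (rayIntegral f) (f z) z := by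
  obtain ⟨G, -, hfG⟩ := exists_rayIntegral_eventuallyEq hS hf h0
  filter_upwards [eventually_eventually_nhdsWithin.2 hfG, self_mem_nhdsWithin] with z hz hz0
  rw [Complex.isOpen_slitPlane.nhdsWithin_eq hz0] at hz
  exact hz.self_of_nhds.2.congr_of_eventuallyEq (hz.mono fun u hu => hu.1)

/-- Near `0` the ray integral is a primitive by the expansion of `f`; scaling the ray by a small
`ε` and integrating `f` over the rest of the segment carries this over to `z`. -/
theorem hasDerivAt_rayIntegral (hS : S.Finite) (hf : DifferentiableOn ℂ f (cutPlane S))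
    (h0 : HasLogExpansion (fun z => z * f z) 0) {z : ℂ} (hz : z ∈ cutPlane S) :
    HasDerivAt (rayIntegral f) (f z) z := by
  have hsmall : ∀ᶠ ε : ℝ in 𝓝[>] 0, HasDerivAt (rayIntegral f) (f (ε * z)) (ε * z) :=
    (tendsto_real_mul_slitPlane hz.1).eventually
      (eventually_hasDerivAt_rayIntegral hS hf.continuousOn h0)
  obtain ⟨ε, hε, hε0, hε1⟩ := (hsmall.and (Ioo_mem_nhdsGT one_pos)).exists
  obtain ⟨H, hHε, hHz, hH⟩ := exists_eventually_integral_ray_eq_sub (isOpen_cutPlane hS) hf hε1.le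
    fun s hs => real_mul_mem_cutPlane hz (hε0.trans_le hs.1) hs.2
  have hsplit : rayIntegral f =ᶠ[𝓝 z] fun u => rayIntegral f (ε * u) + (H u - H (ε * u)) := by
    filter_upwards [hH, (isOpen_cutPlane hS).mem_nhds hz] with u hu huS
    rw [← hu]
    exact rayIntegral_eq_rayIntegral_mul_add ⟨hε0.le, hε1.le⟩
      (intervalIntegrable_ray hf.continuousOn h0 huS)
  have hscale : HasDerivAt (fun u : ℂ => (ε : ℂ) * u) ε z := by
    simpa using (hasDerivAt_id z).const_mul (ε : ℂ)
  refine (((hε.comp z hscale).add (hHz.sub (hHε.comp z hscale))).congr_of_eventuallyEq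
    hsplit).congr_deriv ?_
  ring

end RayIntegral

section Hyperlog

open Classical in
/-- The values at `0` of the coefficients of `hyperlog w` as a polynomial in `log z`. -/
noncomputable def hyperlogValues (w : List ℂ) : ℕ → ℂ :=
  if ∀ x ∈ w, x = 0 then Pi.single w.length ((w.length.factorial : ℂ)⁻¹) else 0

theorem hyperlogValues_apply_zero {w : List ℂ} (hw : w ≠ []) : hyperlogValues w 0 = 0 := by
  have : 0 ≠ w.length := by simpa [eq_comm] using hw
  rw [hyperlogValues]
  split_ifs <;> simp [this]

theorem hyperlog_of_forall_eq_zero {w : List ℂ} (hw : ∀ x ∈ w, x = 0) :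
    hyperlog w = fun z => Complex.log z ^ w.length * (w.length.factorial : ℂ)⁻¹ := by
  funext z
  cases w with
  | nil => simp [hyperlog]
  | cons σ w => rw [hyperlog, if_pos hw, List.length_cons, div_eq_mul_inv]

theorem hyperlog_cons_eq_rayIntegral {σ : ℂ} {w : List ℂ} (hw : ¬ ∀ x ∈ σ :: w, x = 0) :
    hyperlog (σ :: w) = rayIntegral fun z => hyperlog w z / (z - σ) := by
  funext z
  rw [hyperlog, if_neg hw, rayIntegral]
  simp only [div_mul_eq_mul_div, mul_div_assoc]

theorem hasLogExpansion_hyperlog_of_forall_eq_zero {w : List ℂ} (hw : ∀ x ∈ w, x = 0) :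
    HasLogExpansion (hyperlog w) (hyperlogValues w) := by
  rw [hyperlogValues, if_pos hw, hyperlog_of_forall_eq_zero hw]
  exact .log_pow_smul (g := fun _ => ((w.length.factorial : ℂ)⁻¹)) analyticAt_const w.length

theorem hasDerivAt_hyperlog_cons_of_forall_eq_zero {σ : ℂ} {w : List ℂ}
    (hw : ∀ x ∈ σ :: w, x = 0) {z : ℂ} (hz : z ∈ Complex.slitPlane) :
    HasDerivAt (hyperlog (σ :: w)) (hyperlog w z / (z - σ)) z := by
  obtain ⟨rfl, hw'⟩ := List.forall_mem_cons.1 hw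
  rw [hyperlog_of_forall_eq_zero hw, hyperlog_of_forall_eq_zero hw', List.length_cons]
  refine ((hasDerivAt_log_pow_succ hz w.length).mul_const _).congr_deriv ?_
  have hsucc : ((w.length : ℂ) + 1) ≠ 0 := Nat.cast_add_one_ne_zero _
  rw [Nat.factorial_succ]
  push_cast
  rw [sub_zero]
  field_simp

theorem hasLogExpansion_mul_hyperlog_div_sub {σ : ℂ} {w : List ℂ} (hnz : ¬ ∀ x ∈ σ :: w, x = 0)
    (hw : HasLogExpansion (hyperlog w) (hyperlogValues w)) :
    HasLogExpansion (fun z => z * (hyperlog w z / (z - σ))) 0 := by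
  by_cases hσ : σ = 0
  · have hvalues : hyperlogValues w = 0 :=
      if_neg fun h => hnz (List.forall_mem_cons.2 ⟨hσ, h⟩)
    refine (hvalues ▸ hw).congr ?_
    filter_upwards [self_mem_nhdsWithin] with z hz
    have := Complex.slitPlane_ne_zero hz
    rw [hσ, sub_zero, mul_div_cancel₀ _ this]
  · have hk : AnalyticAt ℂ (fun z : ℂ => z * (z - σ)⁻¹) 0 :=
      analyticAt_id.mul ((analyticAt_id.sub analyticAt_const).inv (by simpa using hσ))
    have h0 : (fun i => 0 * (0 - σ)⁻¹ * hyperlogValues w i) = 0 := by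
      funext i
      simp
    exact h0 ▸ (hw.analytic_mul hk).congr (.of_forall fun z => by ring)

variable {S : Set ℂ}

theorem hasLogExpansion_hyperlog_and_differentiableOn (hS : S.Finite) {w : List ℂ}
    (hw : ∀ σ ∈ w, σ ∈ S) :
    HasLogExpansion (hyperlog w) (hyperlogValues w) ∧
      DifferentiableOn ℂ (hyperlog w) (cutPlane S) := by
  induction w with
  | nil =>
    refine ⟨hasLogExpansion_hyperlog_of_forall_eq_zero (by simp), ?_⟩
    exact (differentiableOn_const (1 : ℂ)).congr fun z _ => by rw [hyperlog]
  | cons σ w ih =>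
    obtain ⟨hσ, hw⟩ := List.forall_mem_cons.1 hw
    obtain ⟨ihe, ihd⟩ := ih hw
    by_cases h0 : ∀ x ∈ σ :: w, x = 0
    · exact ⟨hasLogExpansion_hyperlog_of_forall_eq_zero h0, fun z hz =>
        (hasDerivAt_hyperlog_cons_of_forall_eq_zero h0
          hz.1).differentiableAt.differentiableWithinAt⟩
    · have hf : DifferentiableOn ℂ (fun z => hyperlog w z / (z - σ)) (cutPlane S) :=
        ihd.div (by fun_prop) fun z hz => sub_ne_zero.2 (ne_of_mem_cutPlane hz hσ)
      have hf0 := hasLogExpansion_mul_hyperlog_div_sub h0 ihe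
      rw [hyperlogValues, if_neg h0, hyperlog_cons_eq_rayIntegral h0]
      exact ⟨hasLogExpansion_rayIntegral hS hf.continuousOn hf0, fun z hz =>
        (hasDerivAt_rayIntegral hS hf hf0 hz).differentiableAt.differentiableWithinAt⟩

theorem hasLogExpansion_hyperlog (w : List ℂ) : HasLogExpansion (hyperlog w) (hyperlogValues w) :=
  (hasLogExpansion_hyperlog_and_differentiableOn (List.finite_toSet w) fun _ h => h).1

theorem differentiableOn_hyperlog (hS : S.Finite) {w : List ℂ} (hw : ∀ σ ∈ w, σ ∈ S) :
    DifferentiableOn ℂ (hyperlog w) (cutPlane S) :=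
  (hasLogExpansion_hyperlog_and_differentiableOn hS hw).2

theorem hasDerivAt_hyperlog_cons (hS : S.Finite) {σ : ℂ} {w : List ℂ}
    (hσw : ∀ τ ∈ σ :: w, τ ∈ S) {z : ℂ} (hz : z ∈ cutPlane S) :
    HasDerivAt (hyperlog (σ :: w)) (hyperlog w z / (z - σ)) z := by
  by_cases h0 : ∀ x ∈ σ :: w, x = 0
  · exact hasDerivAt_hyperlog_cons_of_forall_eq_zero h0 hz.1
  · obtain ⟨hσ, hw⟩ := List.forall_mem_cons.1 hσw
    rw [hyperlog_cons_eq_rayIntegral h0]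
    exact hasDerivAt_rayIntegral hS ((differentiableOn_hyperlog hS hw).div (by fun_prop)
      fun z hz => sub_ne_zero.2 (ne_of_mem_cutPlane hz hσ))
      (hasLogExpansion_mul_hyperlog_div_sub h0 (hasLogExpansion_hyperlog w)) hz

end Hyperlog

section BanachHyperlog

theorem map_ringInverse {M N F : Type*} [MonoidWithZero M] [MonoidWithZero N] [FunLike F M N]
    [MonoidHomClass F M N] (f : F) {a : M} (ha : IsUnit a) :
    f (Ring.inverse a) = Ring.inverse (f a) := by
  obtain ⟨u, rfl⟩ := ha
  rw [Ring.inverse_unit]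
  exact (Ring.inverse_unit (Units.map (f : M →* N) u)).symm

variable {A : Type*} [NormedCommRing A] [NormedAlgebra ℂ A]

/-- `L` is the hyperlogarithm on `(0, ∞)` of a word of letters in a Banach algebra: the solution
of `L' = (x - a)⁻¹ L_w` with regularized limit `0` at `0`. For an algebra of functions of a
parameter this is a hyperlogarithm whose letters depend on the parameter. -/
def IsHyperlog : List A → (ℝ → A) → Prop
  | [], L => ∀ x, 0 < x → L x = 1
  | a :: w, L => HasRegLim L 0 ∧ ∃ L', IsHyperlog w L' ∧
      ∀ x : ℝ, 0 < x → HasDerivAt L (Ring.inverse (algebraMap ℂ A x - a) * L' x) x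

/-- The elements of a Banach algebra over which hyperlogarithms exist on `(0, ∞)`: for a complex
number `a` this says that `a ∉ (0, ∞)`. -/
structure IsHyperlogLetter (a : A) : Prop where
  isUnit_sub : ∀ x : ℝ, 0 < x → IsUnit (algebraMap ℂ A x - a)
  eq_zero_or_isUnit : a = 0 ∨ IsUnit a

theorem analyticAt_ringInverse_comp [CompleteSpace A] {L : ℂ → A} {z : ℂ} (hL : AnalyticAt ℂ L z)
    (hu : IsUnit (L z)) : AnalyticAt ℂ (fun z => Ring.inverse (L z)) z := by
  obtain ⟨u, hu⟩ := hu
  exact AnalyticAt.comp (g := Ring.inverse) (hu ▸ analyticAt_inverse u) hL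

theorem IsHyperlogLetter.exists_analyticAt_inverse_sub [CompleteSpace A] {a : A}
    (ha : IsHyperlogLetter a) :
    ∃ K : ℂ → A, AnalyticAt ℂ K 0 ∧
      ∀ z : ℂ, z ≠ 0 → Ring.inverse (algebraMap ℂ A z - a) = z⁻¹ • K z := by
  rcases ha.eq_zero_or_isUnit with rfl | hu
  · refine ⟨fun _ => 1, analyticAt_const, fun z hz => ?_⟩
    rw [sub_zero, ← map_ringInverse _ hz.isUnit, Ring.inverse_eq_inv',
      Algebra.algebraMap_eq_smul_one]
  · refine ⟨fun z => z • Ring.inverse (algebraMap ℂ A z - a), analyticAt_id.smul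
      (analyticAt_ringInverse_comp (((algebraMapCLM ℂ A).analyticAt 0).sub analyticAt_const) ?_),
      fun z hz => (inv_smul_smul₀ hz _).symm⟩
    rwa [map_zero, zero_sub, IsUnit.neg_iff]

theorem inverse_algebraMap_inv_sub {y : ℂ} (hy : y ≠ 0) (a : A) :
    Ring.inverse (algebraMap ℂ A y⁻¹ - a) = y • Ring.inverse (1 - y • a) := by
  have hfactor : algebraMap ℂ A y⁻¹ - a = algebraMap ℂ A y⁻¹ * (1 - y • a) := by
    rw [← Algebra.smul_def, smul_sub, inv_smul_smul₀ hy, Algebra.algebraMap_eq_smul_one]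
  have hu : IsUnit y⁻¹ := (inv_ne_zero hy).isUnit
  rw [hfactor, Ring.inverse_mul (.inl (hu.map _)), ← map_ringInverse _ hu, Ring.inverse_eq_inv',
    inv_inv, mul_comm, ← Algebra.smul_def]

variable {w : List A} {L M : ℝ → A}

theorem IsHyperlog.exists_hasRegLim (h : IsHyperlog w L) : ∃ r, HasRegLim L r := by
  cases w with
  | nil => exact ⟨1, (HasRegLim.const 1).congr (eventually_mem_nhdsWithin.mono h)⟩
  | cons a w => exact ⟨0, h.1⟩

theorem IsHyperlog.continuousOn (h : IsHyperlog w L) : ContinuousOn L (Set.Ioi 0) := by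
  cases w with
  | nil => exact continuousOn_const.congr h
  | cons a w =>
    obtain ⟨-, L', -, hL⟩ := h
    exact fun x hx => (hL x hx).continuousAt.continuousWithinAt

theorem IsHyperlog.eqOn (h : IsHyperlog w L) (h' : IsHyperlog w M) :
    Set.EqOn L M (Set.Ioi 0) := by
  induction w generalizing L M with
  | nil => exact fun x hx => (h x hx).trans (h' x hx).symm
  | cons a w ih =>
    obtain ⟨h0, L', hL', hL⟩ := h
    obtain ⟨h0', M', hM', hM⟩ := h'
    exact eqOn_Ioi_of_hasDerivAt_of_hasRegLim hL
      (fun x hx => ih hL' hM' hx ▸ hM x hx) h0 h0'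

theorem IsHyperlogLetter.map {B : Type*} [NormedCommRing B] [NormedAlgebra ℂ B]
    (φ : A →A[ℂ] B) {a : A} (ha : IsHyperlogLetter a) : IsHyperlogLetter (φ a) where
  isUnit_sub x hx := by
    simpa only [map_sub, AlgHomClass.commutes] using (ha.isUnit_sub x hx).map φ
  eq_zero_or_isUnit := ha.eq_zero_or_isUnit.imp (fun h => by rw [h, map_zero]) fun h => h.map φ

theorem IsHyperlog.map {B : Type*} [NormedCommRing B] [NormedAlgebra ℂ B] (φ : A →A[ℂ] B)
    (hw : ∀ a ∈ w, IsHyperlogLetter a) (h : IsHyperlog w L) :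
    IsHyperlog (w.map φ) fun x => φ (L x) := by
  induction w generalizing L with
  | nil => exact fun x hx => (congrArg φ (h x hx)).trans (map_one φ)
  | cons a w ih =>
    obtain ⟨ha, hw⟩ := List.forall_mem_cons.1 hw
    obtain ⟨h0, L', hL', hL⟩ := h
    refine ⟨map_zero φ ▸ h0.map φ.toContinuousLinearMap, _, ih hw hL', fun x hx => ?_⟩
    have hφ := (φ.toContinuousLinearMap.restrictScalars ℝ).hasFDerivAt.comp_hasDerivAt x (hL x hx)
    refine hφ.congr_deriv ?_
    have hx' : φ (algebraMap ℂ A x - a) = algebraMap ℂ B x - φ a := by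
      rw [map_sub, AlgHomClass.commutes]
    rw [← hx', ← map_ringInverse φ (ha.isUnit_sub x hx), ← map_mul]
    rfl

theorem hasDerivAt_hyperlog_cons_ofReal {σ : ℂ} {w : List ℂ}
    (hw : ∀ τ ∈ σ :: w, ∀ x : ℝ, 0 < x → τ ≠ x) {x : ℝ} (hx : 0 < x) :
    HasDerivAt (fun x : ℝ => hyperlog (σ :: w) x) (((x : ℂ) - σ)⁻¹ * hyperlog w x) x := by
  rw [← div_eq_inv_mul]
  exact (hasDerivAt_hyperlog_cons (List.finite_toSet (σ :: w)) (fun _ h => h)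
    (ofReal_mem_cutPlane hw hx)).comp_ofReal

theorem isHyperlog_hyperlog {w : List ℂ} (hw : ∀ σ ∈ w, ∀ x : ℝ, 0 < x → σ ≠ x) :
    IsHyperlog w fun x => hyperlog w x := by
  induction w with
  | nil => exact fun x _ => hyperlog.eq_1 x
  | cons σ w ih =>
    refine ⟨hyperlogValues_apply_zero (List.cons_ne_nil σ w) ▸
      (hasLogExpansion_hyperlog (σ :: w)).hasRegLim, _, ih fun τ hτ => hw τ (.tail _ hτ),
      fun x hx => (hasDerivAt_hyperlog_cons_ofReal hw hx).congr_deriv ?_⟩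
    rw [Ring.inverse_eq_inv]
    rfl

theorem IsHyperlog.character_apply_eq_hyperlog (χ : A →A[ℂ] ℂ)
    (hw : ∀ a ∈ w, IsHyperlogLetter a) (h : IsHyperlog w L) {x : ℝ} (hx : 0 < x) :
    χ (L x) = hyperlog (w.map χ) x := by
  refine (h.map χ hw).eqOn (isHyperlog_hyperlog ?_) hx
  rintro _ hσ y hy rfl
  obtain ⟨a, ha, hay⟩ := List.mem_map.1 hσ
  exact (((hw a ha).map χ).isUnit_sub y hy).ne_zero (by rw [hay]; exact sub_self _)

variable [CompleteSpace A]

theorem continuousOn_inverse_algebraMap_sub {a : A} (ha : IsHyperlogLetter a) :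
    ContinuousOn (fun x : ℝ => Ring.inverse (algebraMap ℂ A x - a)) (Set.Ioi 0) := by
  refine fun x hx => ContinuousAt.continuousWithinAt ?_
  have hsub : AnalyticAt ℂ (fun z : ℂ => algebraMap ℂ A z - a) x :=
    ((algebraMapCLM ℂ A).analyticAt _).fun_sub analyticAt_const
  exact (analyticAt_ringInverse_comp hsub (ha.isUnit_sub x hx)).continuousAt.comp
    Complex.continuous_ofReal.continuousAt

theorem exists_hasDerivAt_of_continuousOn_Ioi {f : ℝ → A} (hf : ContinuousOn f (Set.Ioi 0)) :
    ∃ F : ℝ → A, ∀ x, 0 < x → HasDerivAt F (f x) x := by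
  refine ⟨fun x => ∫ s in (1 : ℝ)..x, f s, fun x hx => ?_⟩
  have hsub : Set.uIcc 1 x ⊆ Set.Ioi 0 := fun s hs =>
    lt_of_lt_of_le (lt_min one_pos hx) hs.1
  exact intervalIntegral.integral_hasDerivAt_right (hf.mono hsub).intervalIntegrable
    (hf.stronglyMeasurableAtFilter isOpen_Ioi x hx) (hf.continuousAt (Ioi_mem_nhds hx))

theorem exists_isHyperlog (hw : ∀ a ∈ w, IsHyperlogLetter a) : ∃ L, IsHyperlog w L := by
  induction w with
  | nil => exact ⟨fun _ => 1, fun _ _ => rfl⟩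
  | cons a w ih =>
    obtain ⟨ha, hw⟩ := List.forall_mem_cons.1 hw
    obtain ⟨L', hL'⟩ := ih hw
    obtain ⟨F, hF⟩ := exists_hasDerivAt_of_continuousOn_Ioi
      ((continuousOn_inverse_algebraMap_sub ha).mul hL'.continuousOn)
    obtain ⟨K, hK, hKa⟩ := ha.exists_analyticAt_inverse_sub
    obtain ⟨r, hr⟩ := hL'.exists_hasRegLim
    obtain ⟨c, hc⟩ := (hr.analytic_mul hK).exists_of_hasDerivAt (F := F) (by
      filter_upwards [self_mem_nhdsWithin] with x (hx : 0 < x)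
      refine (hF x hx).congr_deriv ?_
      rw [Pi.mul_apply, hKa _ (Complex.ofReal_ne_zero.2 hx.ne'), smul_mul_assoc])
    exact ⟨fun x => F x - c, sub_self c ▸ hc.sub (.const c), L', hL', fun x hx =>
      (hF x hx).sub_const c⟩

theorem IsHyperlog.exists_hasRegLim_inv (h : IsHyperlog w L) :
    ∃ r, HasRegLim (fun y => L y⁻¹) r := by
  induction w generalizing L with
  | nil =>
    refine ⟨1, (HasRegLim.const 1).congr ?_⟩
    filter_upwards [self_mem_nhdsWithin] with y (hy : 0 < y) using h _ (inv_pos.2 hy)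
  | cons a w ih =>
    obtain ⟨-, L', hL', hL⟩ := h
    obtain ⟨r, hr⟩ := ih hL'
    have hK : AnalyticAt ℂ (fun y : ℂ => -Ring.inverse (1 - y • a)) 0 :=
      (analyticAt_ringInverse_comp (analyticAt_const.sub (analyticAt_id.smul analyticAt_const))
        (by simp)).neg
    refine (hr.analytic_mul hK).exists_of_hasDerivAt ?_
    filter_upwards [self_mem_nhdsWithin] with y (hy : 0 < y)
    have hy0 : (y : ℂ) ≠ 0 := Complex.ofReal_ne_zero.2 hy.ne'
    refine ((hL y⁻¹ (inv_pos.2 hy)).scomp y (hasDerivAt_inv hy.ne')).congr_deriv ?_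
    rw [Complex.ofReal_inv, inverse_algebraMap_inv_sub hy0, ← Complex.coe_smul, smul_mul_assoc,
      smul_smul, neg_mul, smul_neg, ← neg_smul]
    congr 1
    push_cast
    field_simp

/-- The regularized limit of `hyperlog w` at `∞`. -/
noncomputable def hyperlogReg (w : List ℂ) : ℂ := regLimInf (hyperlog w)

theorem hasRegLimInf_hyperlog {w : List ℂ} (hw : ∀ σ ∈ w, ∀ x : ℝ, 0 < x → σ ≠ x) :
    HasRegLimInf (hyperlog w) (hyperlogReg w) := by
  obtain ⟨r, hr⟩ := (isHyperlog_hyperlog hw).exists_hasRegLim_inv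
  have h : HasRegLimInf (hyperlog w) r := hasRegLimInf_iff.2 (by simpa using! hr)
  rwa [hyperlogReg, h.regLimInf_eq]

end BanachHyperlog

section WordDeriv

variable {ι R : Type*} [Ring R] {M : Type*} [AddCommGroup M] [Module R M]

/-- The derivation of words which governs the derivative of a hyperlogarithm with respect to a
parameter: `m i j` stands for the logarithmic derivative of `i - j` (or for the part of it which
belongs to one zero or pole), and `o` for the letter `0`. -/
noncomputable def wordDeriv (m : ι → ι → R) (o : ι) : List ι → (List ι →₀ R)
  | [] => 0
  | [i] => Finsupp.single [] (-m i o)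
  | i :: j :: w => (wordDeriv m o (j :: w)).mapDomain (List.cons i) +
      (Finsupp.single (i :: w) (m i j) + Finsupp.single (j :: w) (-m i j))

theorem linearCombination_wordDeriv_singleton (m : ι → ι → R) (o i : ι) (Λ : List ι → M) :
    Finsupp.linearCombination R Λ (wordDeriv m o [i]) = -m i o • Λ [] := by
  rw [wordDeriv, Finsupp.linearCombination_single]

theorem linearCombination_wordDeriv_cons_cons (m : ι → ι → R) (o i j : ι) (w : List ι)
    (Λ : List ι → M) :
    Finsupp.linearCombination R Λ (wordDeriv m o (i :: j :: w)) =
      Finsupp.linearCombination R (fun u => Λ (i :: u)) (wordDeriv m o (j :: w)) +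
        m i j • (Λ (i :: w) - Λ (j :: w)) := by
  rw [wordDeriv, map_add, map_add, Finsupp.linearCombination_mapDomain,
    Finsupp.linearCombination_single, Finsupp.linearCombination_single, smul_sub, neg_smul,
    ← sub_eq_add_neg]
  rfl

theorem length_of_mem_support_wordDeriv (m : ι → ι → R) (o : ι) {u w : List ι}
    (hu : u ∈ (wordDeriv m o w).support) : u.length + 1 = w.length := by
  classical
  induction w generalizing u with
  | nil => simp [wordDeriv] at hu
  | cons i w ih =>
    cases w with
    | nil => rw [Finset.mem_singleton.1 (Finsupp.support_single_subset hu)]; rfl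
    | cons j w =>
      rcases Finset.mem_union.1 (Finsupp.support_add hu) with h | h
      · obtain ⟨u', hu', rfl⟩ := Finset.mem_image.1 (Finsupp.mapDomain_support h)
        exact congrArg (· + 1) (ih hu')
      · rcases Finset.mem_union.1 (Finsupp.support_add h) with h | h <;>
        · rw [Finset.mem_singleton.1 (Finsupp.support_single_subset h)]
          rfl

theorem linearCombination_wordDeriv_sum {κ : Type*} (T : Finset κ) (c : κ → ℂ)
    (m : κ → ι → ι → ℚ) (o : ι) (w : List ι) (Λ : List ι → ℂ) :
    Finsupp.linearCombination ℂ Λ (wordDeriv (fun i j => ∑ τ ∈ T, c τ * m τ i j) o w) =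
      ∑ τ ∈ T, c τ * Finsupp.linearCombination ℚ Λ (wordDeriv (m τ) o w) := by
  induction w generalizing Λ with
  | nil => simp [wordDeriv]
  | cons i w ih =>
    cases w with
    | nil =>
      simp only [linearCombination_wordDeriv_singleton, Rat.smul_def, smul_eq_mul,
        ← Finset.sum_neg_distrib, Finset.sum_mul]
      exact Finset.sum_congr rfl fun τ _ => by push_cast; ring
    | cons j w =>
      simp only [linearCombination_wordDeriv_cons_cons, ih, Rat.smul_def, smul_eq_mul,
        Finset.sum_mul, mul_add, mul_assoc, Finset.sum_add_distrib]

end WordDeriv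

section LinearCombination

variable {ι R E : Type*} [Semiring R] [NormedAddCommGroup E] [Module R E] [ContinuousConstSMul R E]

theorem hasDerivAt_linearCombination {𝕜 : Type*} [NontriviallyNormedField 𝕜] [NormedSpace 𝕜 E]
    [SMulCommClass 𝕜 R E] {Λ : ι → 𝕜 → E} {Λ' : ι → E} {x : 𝕜}
    (h : ∀ u, HasDerivAt (Λ u) (Λ' u) x) (v : ι →₀ R) :
    HasDerivAt (fun x => Finsupp.linearCombination R (fun u => Λ u x) v)
      (Finsupp.linearCombination R Λ' v) x := by
  simp only [Finsupp.linearCombination_apply, Finsupp.sum]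
  exact HasDerivAt.fun_sum fun u _ => (h u).fun_const_smul (v u)

theorem HasRegLim.linearCombination [NormedSpace ℂ E] [SMulCommClass ℂ R E] {f : ι → ℝ → E}
    {r : ι → E} (h : ∀ u, HasRegLim (f u) (r u)) (v : ι →₀ R) :
    HasRegLim (fun x => Finsupp.linearCombination R (fun u => f u x) v)
      (Finsupp.linearCombination R r v) := by
  simp only [Finsupp.linearCombination_apply, Finsupp.sum]
  exact HasRegLim.sum _ fun u _ => (h u).map (v u • ContinuousLinearMap.id ℂ E)

end LinearCombination

section ParamDeriv

variable {ι : Type*}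

/-- `a'` is a possible derivative of the letters `a` with respect to a parameter, the letters not
lying on `(0, ∞)` and `ω i j` being the logarithmic derivative of `a i - a j`. -/
structure IsLetterVariation (a a' : ι → ℂ) (ω : ι → ι → ℂ) (o : ι) : Prop where
  ne_pos : ∀ i, ∀ x : ℝ, 0 < x → a i ≠ x
  zero : a o = 0
  deriv_zero : a' o = 0
  deriv_sub : ∀ i j, a' i - a' j = ω i j * (a i - a j)
  logDeriv_eq_zero : ∀ i, a i = 0 → ω i o = 0

/-- The boundary term in the derivative of a hyperlogarithm with respect to a parameter. -/
noncomputable def headTerm (a a' : ι → ℂ) : List ι → ℝ → ℂ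
  | [], _ => 0
  | i :: w, x => a' i * ((x - a i)⁻¹ * hyperlog (w.map a) x)

/-- The derivative of `hyperlog (w.map a) x` with respect to a parameter, if `a'` is the
derivative of `a`. -/
noncomputable def paramDeriv (a a' : ι → ℂ) (ω : ι → ι → ℂ) (o : ι) (w : List ι) (x : ℝ) : ℂ :=
  Finsupp.linearCombination ℂ (fun u => hyperlog (u.map a) x) (wordDeriv ω o w) - headTerm a a' w x

theorem linearCombination_hyperlogValues_wordDeriv_cons (a : ι → ℂ) (ω : ι → ι → ℂ) (o i : ι)
    (w : List ι) :
    Finsupp.linearCombination ℂ (fun u => hyperlogValues (u.map a) 0) (wordDeriv ω o (i :: w)) =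
      -ω i o * hyperlogValues (w.map a) 0 := by
  have hcons (j : ι) (u : List ι) : hyperlogValues ((j :: u).map a) 0 = 0 :=
    hyperlogValues_apply_zero (List.cons_ne_nil _ _)
  cases w with
  | nil => exact linearCombination_wordDeriv_singleton ω o i _
  | cons j w =>
    rw [linearCombination_wordDeriv_cons_cons]
    simp only [hcons, sub_self, smul_zero, mul_zero, add_zero, Finsupp.linearCombination_apply,
      Finsupp.sum, Finset.sum_const_zero]

variable {a a' : ι → ℂ} {ω : ι → ι → ℂ} {o : ι}

namespace IsLetterVariation

theorem deriv_eq (h : IsLetterVariation a a' ω o) (i : ι) : a' i = ω i o * a i := by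
  simpa [h.zero, h.deriv_zero] using h.deriv_sub i o

theorem map_ne_pos (h : IsLetterVariation a a' ω o) (w : List ι) :
    ∀ σ ∈ w.map a, ∀ x : ℝ, 0 < x → σ ≠ x := by
  intro σ hσ
  obtain ⟨i, -, rfl⟩ := List.mem_map.1 hσ
  exact h.ne_pos i

theorem sub_ne_zero (h : IsLetterVariation a a' ω o) (i : ι) {x : ℝ} (hx : 0 < x) :
    (x : ℂ) - a i ≠ 0 :=
  _root_.sub_ne_zero.2 (h.ne_pos i x hx).symm

theorem logDeriv_mul_inv_sub_inv (h : IsLetterVariation a a' ω o) (i j : ι) {x : ℝ}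
    (hx : 0 < x) : ω i j * (((x : ℂ) - a i)⁻¹ - ((x : ℂ) - a j)⁻¹) =
      (a' i - a' j) * (((x : ℂ) - a i)⁻¹ * ((x : ℂ) - a j)⁻¹) := by
  rw [h.deriv_sub, inv_sub_inv (h.sub_ne_zero i hx) (h.sub_ne_zero j hx), sub_sub_sub_cancel_left,
    div_eq_mul_inv, mul_inv, mul_assoc]

theorem hasDerivAt_hyperlog_map_cons (h : IsLetterVariation a a' ω o) (i : ι) (w : List ι)
    {x : ℝ} (hx : 0 < x) : HasDerivAt (fun x : ℝ => hyperlog ((i :: w).map a) x)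
      (((x : ℂ) - a i)⁻¹ * hyperlog (w.map a) x) x :=
  hasDerivAt_hyperlog_cons_ofReal (h.map_ne_pos (i :: w)) hx

theorem hasDerivAt_inv_sub (h : IsLetterVariation a a' ω o) (i : ι) {x : ℝ} (hx : 0 < x) :
    HasDerivAt (fun x : ℝ => ((x : ℂ) - a i)⁻¹) (-((x : ℂ) - a i)⁻¹ ^ 2) x := by
  have hsub : HasDerivAt (fun x : ℝ => (x : ℂ) - a i) 1 x :=
    (Complex.ofRealCLM.hasDerivAt (x := x)).sub_const (a i)
  exact (hsub.fun_inv (h.sub_ne_zero i hx)).congr_deriv (by rw [inv_pow, neg_div, one_div])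

theorem hasDerivAt_paramDeriv_singleton (h : IsLetterVariation a a' ω o) (i : ι) {x : ℝ}
    (hx : 0 < x) :
    HasDerivAt (paramDeriv a a' ω o [i]) (a' i * ((x : ℂ) - a i)⁻¹ ^ 2) x := by
  have hparam : paramDeriv a a' ω o [i] = fun x : ℝ => -ω i o - a' i * ((x : ℂ) - a i)⁻¹ := by
    funext x
    simp [paramDeriv, linearCombination_wordDeriv_singleton, headTerm, hyperlog]
  rw [hparam]
  exact (((h.hasDerivAt_inv_sub i hx).const_mul (a' i)).const_sub (-ω i o)).congr_deriv (by ring)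

theorem hasDerivAt_paramDeriv_cons_cons (h : IsLetterVariation a a' ω o) (i j : ι) (w : List ι)
    {x : ℝ} (hx : 0 < x) :
    HasDerivAt (paramDeriv a a' ω o (i :: j :: w))
      (((x : ℂ) - a i)⁻¹ * paramDeriv a a' ω o (j :: w) x +
        a' i * (((x : ℂ) - a i)⁻¹ ^ 2 * hyperlog ((j :: w).map a) x)) x := by
  have hlc := hasDerivAt_linearCombination
    (fun u => h.hasDerivAt_hyperlog_map_cons i u hx) (wordDeriv ω o (j :: w))
  have hdiff := ((h.hasDerivAt_hyperlog_map_cons i w hx).fun_sub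
    (h.hasDerivAt_hyperlog_map_cons j w hx)).const_mul (ω i j)
  have hhead := ((h.hasDerivAt_inv_sub i hx).fun_mul
    (h.hasDerivAt_hyperlog_map_cons j w hx)).const_mul (a' i)
  have hpull : Finsupp.linearCombination ℂ (fun u => ((x : ℂ) - a i)⁻¹ * hyperlog (u.map a) x)
      (wordDeriv ω o (j :: w)) = ((x : ℂ) - a i)⁻¹ *
        Finsupp.linearCombination ℂ (fun u => hyperlog (u.map a) x) (wordDeriv ω o (j :: w)) := by
    simp only [Finsupp.linearCombination_apply, Finsupp.sum, Finset.mul_sum, smul_eq_mul,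
      mul_left_comm]
  refine (((hlc.fun_add hdiff).fun_sub hhead).congr_deriv ?_).congr_of_eventuallyEq
    (.of_forall fun y => ?_)
  · rw [hpull, ← sub_mul, ← mul_assoc, h.logDeriv_mul_inv_sub_inv i j hx, paramDeriv, headTerm]
    ring
  · simp only [paramDeriv, linearCombination_wordDeriv_cons_cons, headTerm, smul_eq_mul]

theorem hasDerivAt_paramDeriv_cons (h : IsLetterVariation a a' ω o) (i : ι) (w : List ι)
    {x : ℝ} (hx : 0 < x) :
    HasDerivAt (paramDeriv a a' ω o (i :: w))
      (((x : ℂ) - a i)⁻¹ * paramDeriv a a' ω o w x +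
        a' i * (((x : ℂ) - a i)⁻¹ ^ 2 * hyperlog (w.map a) x)) x := by
  cases w with
  | nil =>
    exact (h.hasDerivAt_paramDeriv_singleton i hx).congr_deriv
      (by simp [paramDeriv, wordDeriv, headTerm, hyperlog])
  | cons j w => exact h.hasDerivAt_paramDeriv_cons_cons i j w hx

theorem hasRegLim_headTerm_cons (h : IsLetterVariation a a' ω o) (i : ι) (w : List ι) :
    HasRegLim (headTerm a a' (i :: w)) (-ω i o * hyperlogValues (w.map a) 0) := by
  by_cases hi : a i = 0
  · have hhead : headTerm a a' (i :: w) = fun _ => 0 := by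
      funext x
      rw [headTerm, h.deriv_eq, hi, mul_zero, zero_mul]
    rw [hhead, h.logDeriv_eq_zero i hi, neg_zero, zero_mul]
    exact .const 0
  · have hk : AnalyticAt ℂ (fun z : ℂ => a' i * (z - a i)⁻¹) 0 :=
      analyticAt_const.mul ((analyticAt_id.sub analyticAt_const).inv (by simpa using hi))
    have hω : -ω i o = a' i * (0 - a i)⁻¹ := by
      rw [h.deriv_eq, zero_sub, inv_neg, mul_neg, mul_inv_cancel_right₀ hi]
    rw [hω]
    exact ((hasLogExpansion_hyperlog (w.map a)).hasRegLim.analytic_mul hk).congr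
      (.of_forall fun x => (mul_assoc _ _ _).symm)

theorem hasRegLim_paramDeriv_cons (h : IsLetterVariation a a' ω o) (i : ι) (w : List ι) :
    HasRegLim (paramDeriv a a' ω o (i :: w)) 0 := by
  have hlc := HasRegLim.linearCombination
    (fun u : List ι => (hasLogExpansion_hyperlog (u.map a)).hasRegLim) (wordDeriv ω o (i :: w))
  rw [linearCombination_hyperlogValues_wordDeriv_cons] at hlc
  exact sub_self (_ : ℂ) ▸ hlc.sub (h.hasRegLim_headTerm_cons i w)

theorem hasRegLim_hyperlog_inv (h : IsLetterVariation a a' ω o) (w : List ι) :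
    HasRegLim (fun y : ℝ => hyperlog (w.map a) (y⁻¹ : ℝ)) (hyperlogReg (w.map a)) := by
  simpa using! hasRegLimInf_iff.1 (hasRegLimInf_hyperlog (h.map_ne_pos w))

theorem hasRegLim_headTerm_inv (h : IsLetterVariation a a' ω o) (w : List ι) :
    HasRegLim (fun y => headTerm a a' w y⁻¹) 0 := by
  cases w with
  | nil => exact .const 0
  | cons i w =>
    have hk : AnalyticAt ℂ (fun y : ℂ => a' i * (y * (1 - y * a i)⁻¹)) 0 :=
      analyticAt_const.mul (analyticAt_id.mul
        ((analyticAt_const.sub (analyticAt_id.mul analyticAt_const)).inv (by simp)))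
    have hreg := (h.hasRegLim_hyperlog_inv w).analytic_mul hk
    rw [zero_mul, mul_zero, zero_mul] at hreg
    refine hreg.congr ?_
    filter_upwards [self_mem_nhdsWithin] with y (hy : 0 < y)
    have hy0 : (y : ℂ) ≠ 0 := Complex.ofReal_ne_zero.2 hy.ne'
    have hkernel : ((y⁻¹ : ℝ) - a i : ℂ)⁻¹ = y * (1 - y * a i)⁻¹ := by
      simpa [Ring.inverse_eq_inv] using inverse_algebraMap_inv_sub hy0 (a i)
    rw [headTerm, hkernel, mul_assoc (a' i)]

theorem hasRegLim_paramDeriv_inv (h : IsLetterVariation a a' ω o) (w : List ι) :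
    HasRegLim (fun y => paramDeriv a a' ω o w y⁻¹)
      (Finsupp.linearCombination ℂ (fun u => hyperlogReg (u.map a)) (wordDeriv ω o w)) := by
  rw [← sub_zero (Finsupp.linearCombination ℂ _ _)]
  exact (HasRegLim.linearCombination h.hasRegLim_hyperlog_inv (wordDeriv ω o w)).sub
    (h.hasRegLim_headTerm_inv w)

end IsLetterVariation

end ParamDeriv

section PointDerivation

variable {A : Type*} [NormedCommRing A] [NormedAlgebra ℂ A]

/-- `δ` is a point derivation of a Banach algebra at the character `χ`. For an algebra of
holomorphic functions of a parameter, `χ` is the evaluation and `δ` the derivative at a point. -/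
def IsPointDerivation (χ : A →A[ℂ] ℂ) (δ : A →L[ℂ] ℂ) : Prop :=
  ∀ f g, δ (f * g) = χ f * δ g + δ f * χ g

namespace IsPointDerivation

variable {χ : A →A[ℂ] ℂ} {δ : A →L[ℂ] ℂ}

theorem apply_one (h : IsPointDerivation χ δ) : δ 1 = 0 := by
  simpa using h 1 1

theorem apply_algebraMap (h : IsPointDerivation χ δ) (c : ℂ) : δ (algebraMap ℂ A c) = 0 := by
  rw [Algebra.algebraMap_eq_smul_one, map_smul, h.apply_one, smul_zero]

theorem apply_ringInverse (h : IsPointDerivation χ δ) {u : A} (hu : IsUnit u) :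
    δ (Ring.inverse u) = -δ u * (χ u)⁻¹ ^ 2 := by
  have hχu : χ u ≠ 0 := (hu.map χ).ne_zero
  have hχ : χ (Ring.inverse u) = (χ u)⁻¹ := by
    rw [map_ringInverse χ hu, Ring.inverse_eq_inv']
  have hone := h u (Ring.inverse u)
  rw [Ring.mul_inverse_cancel u hu, h.apply_one, hχ] at hone
  linear_combination (-(χ u)⁻¹) * hone - δ (Ring.inverse u) * inv_mul_cancel₀ hχu

variable {ι : Type*} {b : ι → A} {ω : ι → ι → ℂ} {o : ι} {L : ℝ → A}

theorem apply_isHyperlog (h : IsPointDerivation χ δ) (hb : ∀ i, IsHyperlogLetter (b i))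
    (hvar : IsLetterVariation (fun i => χ (b i)) (fun i => δ (b i)) ω o) {w : List ι}
    (hL : IsHyperlog (w.map b) L) {x : ℝ} (hx : 0 < x) :
    δ (L x) = paramDeriv (fun i => χ (b i)) (fun i => δ (b i)) ω o w x := by
  induction w generalizing L x with
  | nil => simp [hL x hx, h.apply_one, paramDeriv, headTerm, wordDeriv]
  | cons i w ih =>
    obtain ⟨h0, L', hL', hL⟩ := hL
    have hderiv (x : ℝ) (hx : 0 < x) :=
      (δ.restrictScalars ℝ).hasFDerivAt.comp_hasDerivAt x (hL x hx)
    refine eqOn_Ioi_of_hasDerivAt_of_hasRegLim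
      (k := fun x => ((x : ℂ) - χ (b i))⁻¹ * paramDeriv _ _ ω o w x +
        δ (b i) * (((x : ℂ) - χ (b i))⁻¹ ^ 2 * hyperlog (w.map fun i => χ (b i)) x))
      (fun x hx => (hderiv x hx).congr_deriv ?_)
      (fun x hx => hvar.hasDerivAt_paramDeriv_cons i w hx)
      (map_zero δ ▸ h0.map δ) (hvar.hasRegLim_paramDeriv_cons i w) hx
    have hu := (hb i).isUnit_sub x hx
    have hχ : χ (algebraMap ℂ A x - b i) = x - χ (b i) := by
      rw [map_sub, AlgHomClass.commutes]
      rfl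
    have hχL : χ (L' x) = hyperlog (w.map fun i => χ (b i)) x := by
      rw [hL'.character_apply_eq_hyperlog χ (by simpa using fun i _ => hb i) hx, List.map_map]
      rfl
    calc δ (Ring.inverse (algebraMap ℂ A x - b i) * L' x)
        = χ (Ring.inverse (algebraMap ℂ A x - b i)) * δ (L' x) +
          δ (Ring.inverse (algebraMap ℂ A x - b i)) * χ (L' x) := h _ _
      _ = _ := by
        rw [map_ringInverse χ hu, Ring.inverse_eq_inv', h.apply_ringInverse hu, hχ, hχL,
          map_sub, h.apply_algebraMap, ih hL' hx]
        ring

theorem apply_reg (h : IsPointDerivation χ δ) (hb : ∀ i, IsHyperlogLetter (b i))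
    (hvar : IsLetterVariation (fun i => χ (b i)) (fun i => δ (b i)) ω o) {w : List ι}
    (hL : IsHyperlog (w.map b) L) {r : A} (hr : HasRegLim (fun y => L y⁻¹) r) :
    δ r = Finsupp.linearCombination ℂ (fun u => hyperlogReg (u.map fun i => χ (b i)))
      (wordDeriv ω o w) := by
  refine (hr.map δ).unique ((hvar.hasRegLim_paramDeriv_inv w).congr ?_)
  filter_upwards [self_mem_nhdsWithin] with y (hy : 0 < y)
  exact h.apply_isHyperlog hb hvar hL (inv_pos.2 hy)

end IsPointDerivation

theorem IsHyperlog.character_apply_reg (χ : A →A[ℂ] ℂ) {w : List A} {L : ℝ → A}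
    (hw : ∀ a ∈ w, IsHyperlogLetter a) (hL : IsHyperlog w L) {r : A}
    (hr : HasRegLim (fun y => L y⁻¹) r) : χ r = hyperlogReg (w.map χ) := by
  refine (HasRegLimInf.regLimInf_eq (hasRegLimInf_iff.2 ?_)).symm
  refine (hr.map χ.toContinuousLinearMap).congr ?_
  filter_upwards [self_mem_nhdsWithin] with y (hy : 0 < y)
  simpa using! (hL.character_apply_eq_hyperlog χ hw (inv_pos.2 hy)).symm

end PointDerivation

section DiscAlgebra

open Metric

variable {t₀ : ℂ} {ρ : ℝ}

/-- The extension by `0` of a function on a closed disc. -/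
noncomputable def discExtend (f : closedBall t₀ ρ → ℂ) : ℂ → ℂ := Function.extend Subtype.val f 0

theorem discExtend_apply (f : closedBall t₀ ρ → ℂ) (p : closedBall t₀ ρ) : discExtend f p = f p :=
  Subtype.val_injective.extend_apply f 0 p

theorem discExtend_eqOn {f : closedBall t₀ ρ → ℂ} {F : ℂ → ℂ} (h : ∀ p, f p = F p) :
    Set.EqOn (discExtend f) F (closedBall t₀ ρ) := fun t ht =>
  (discExtend_apply f ⟨t, ht⟩).trans (h ⟨t, ht⟩)

variable (t₀ ρ) in
/-- The disc algebra: the Banach algebra of the continuous functions on a closed disc that are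
holomorphic in the interior. -/
noncomputable def discAlgebra : Subalgebra ℂ C(closedBall t₀ ρ, ℂ) where
  carrier := {f | DifferentiableOn ℂ (discExtend f) (ball t₀ ρ)}
  mul_mem' {f g} hf hg := (hf.mul hg).congr <| (discExtend_eqOn fun p => by
    simp [discExtend_apply]).mono ball_subset_closedBall
  add_mem' {f g} hf hg := (hf.add hg).congr <| (discExtend_eqOn fun p => by
    simp [discExtend_apply]).mono ball_subset_closedBall
  algebraMap_mem' c := (differentiableOn_const c).congr <| (discExtend_eqOn fun p => by
    simp).mono ball_subset_closedBall

theorem mem_discAlgebra_of_differentiableOn {f : C(closedBall t₀ ρ, ℂ)} {F : ℂ → ℂ}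
    (hF : DifferentiableOn ℂ F (ball t₀ ρ)) (h : ∀ p, f p = F p) : f ∈ discAlgebra t₀ ρ :=
  hF.congr ((discExtend_eqOn h).mono ball_subset_closedBall)

theorem isClosed_discAlgebra : IsClosed (discAlgebra t₀ ρ : Set C(closedBall t₀ ρ, ℂ)) := by
  refine IsSeqClosed.isClosed fun f g hf hg => ?_
  refine TendstoLocallyUniformlyOn.differentiableOn (F := fun n => discExtend (f n))
    (φ := atTop) (TendstoUniformlyOn.tendstoLocallyUniformlyOn ?_) (.of_forall hf) isOpen_ball
  rw [Metric.tendstoUniformlyOn_iff]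
  intro ε hε
  filter_upwards [Metric.tendsto_nhds.1 hg ε hε] with n hn t ht
  have ht' : t ∈ closedBall t₀ ρ := ball_subset_closedBall ht
  calc dist (discExtend g t) (discExtend (f n) t)
      = dist (g ⟨t, ht'⟩) (f n ⟨t, ht'⟩) :=
        congrArg₂ dist (discExtend_apply g ⟨t, ht'⟩) (discExtend_apply (f n) ⟨t, ht'⟩)
    _ ≤ dist g (f n) := ContinuousMap.dist_apply_le_dist _
    _ < ε := dist_comm g (f n) ▸ hn

instance : CompleteSpace (discAlgebra t₀ ρ) := isClosed_discAlgebra.completeSpace_coe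

theorem isUnit_discAlgebra {f : discAlgebra t₀ ρ} (hf : ∀ p, f.1 p ≠ 0) : IsUnit f := by
  refine isUnit_iff_exists_inv.2 ⟨⟨⟨fun p => (f.1 p)⁻¹, f.1.continuous.inv₀ hf⟩,
    mem_discAlgebra_of_differentiableOn (f.2.fun_inv fun t ht => ?_)
      fun p => congrArg Inv.inv (discExtend_apply f.1 p).symm⟩,
    Subtype.ext (ContinuousMap.ext fun p => mul_inv_cancel₀ (hf p))⟩
  exact (discExtend_apply f.1 ⟨t, ball_subset_closedBall ht⟩).trans_ne (hf _)

/-- Evaluation as a character of the disc algebra. -/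
noncomputable def discEval (p : closedBall t₀ ρ) : discAlgebra t₀ ρ →A[ℂ] ℂ :=
  ⟨(ContinuousMap.evalAlgHom ℂ ℂ p).comp (discAlgebra t₀ ρ).val,
    (continuous_eval_const p).comp continuous_subtype_val⟩

theorem diffContOnCl_discExtend (f : discAlgebra t₀ ρ) :
    DiffContOnCl ℂ (discExtend f.1) (ball t₀ ρ) := by
  refine ⟨f.2, ContinuousOn.mono ?_ closure_ball_subset_closedBall⟩
  rw [continuousOn_iff_continuous_domRestrict]
  exact f.1.continuous.congr fun p => (discExtend_apply f.1 p).symm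

theorem differentiableAt_discExtend (hρ : 0 < ρ) (f : discAlgebra t₀ ρ) :
    DifferentiableAt ℂ (discExtend f.1) t₀ :=
  f.2.differentiableAt (ball_mem_nhds t₀ hρ)

theorem norm_deriv_discExtend_le (hρ : 0 < ρ) (f : discAlgebra t₀ ρ) :
    ‖deriv (discExtend f.1) t₀‖ ≤ ρ⁻¹ * ‖f‖ := by
  rw [← div_eq_inv_mul]
  refine Complex.norm_deriv_le_of_forall_mem_sphere_norm_le hρ (diffContOnCl_discExtend f)
    fun t ht => ?_
  have hft := discExtend_apply f.1 ⟨t, sphere_subset_closedBall ht⟩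
  exact hft ▸ f.1.norm_coe_le_norm _

theorem discExtend_eventuallyEq {f : closedBall t₀ ρ → ℂ} {F : ℂ → ℂ} (hρ : 0 < ρ)
    (h : ∀ p, f p = F p) : discExtend f =ᶠ[𝓝 t₀] F :=
  (discExtend_eqOn h).eventuallyEq_of_mem (closedBall_mem_nhds t₀ hρ)

variable (t₀) in
/-- The derivative at the centre, a continuous functional on the disc algebra by Cauchy's
estimate. -/
noncomputable def discDeriv (hρ : 0 < ρ) : discAlgebra t₀ ρ →L[ℂ] ℂ :=
  LinearMap.mkContinuous
    { toFun f := deriv (discExtend f.1) t₀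
      map_add' f g := by
        have hadd := discExtend_eventuallyEq hρ (f := (f + g).1)
          (F := discExtend f.1 + discExtend g.1) fun p => by simp [discExtend_apply]
        rw [hadd.deriv_eq]
        exact deriv_add (differentiableAt_discExtend hρ f) (differentiableAt_discExtend hρ g)
      map_smul' c f := by
        have hsmul := discExtend_eventuallyEq hρ (f := (c • f).1)
          (F := c • discExtend f.1) fun p => by simp [discExtend_apply]
        rw [hsmul.deriv_eq]
        exact deriv_const_smul c (differentiableAt_discExtend hρ f) }
    ρ⁻¹ (norm_deriv_discExtend_le hρ)

theorem hasDerivAt_discDeriv (hρ : 0 < ρ) {f : discAlgebra t₀ ρ} {F : ℂ → ℂ}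
    (h : ∀ p, discEval p f = F p) : HasDerivAt F (discDeriv t₀ hρ f) t₀ :=
  (differentiableAt_discExtend hρ f).hasDerivAt.congr_of_eventuallyEq
    (discExtend_eventuallyEq hρ h).symm

variable (t₀) in
theorem isPointDerivation_discDeriv (hρ : 0 < ρ) :
    IsPointDerivation (A := discAlgebra t₀ ρ) (discEval ⟨t₀, mem_closedBall_self hρ.le⟩)
      (discDeriv t₀ hρ) := by
  intro f g
  have hmul := (differentiableAt_discExtend hρ f).hasDerivAt.mul
    (differentiableAt_discExtend hρ g).hasDerivAt
  refine (hasDerivAt_discDeriv hρ fun p => ?_).unique (hmul.congr_deriv ?_)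
  · exact (congrArg₂ (· * ·) (discExtend_apply f.1 p) (discExtend_apply g.1 p)).symm
  · have hval (f : discAlgebra t₀ ρ) :
        discExtend f.1 t₀ = discEval ⟨t₀, mem_closedBall_self hρ.le⟩ f :=
      discExtend_apply f.1 ⟨t₀, _⟩
    rw [hval, hval, add_comm]
    rfl

theorem exists_discAlgebra_of_differentiableOn {U : Set ℂ} {F : ℂ → ℂ}
    (hF : DifferentiableOn ℂ F U) (hU : closedBall t₀ ρ ⊆ U) :
    ∃ f : discAlgebra t₀ ρ, ∀ p, discEval p f = F p :=
  ⟨⟨⟨fun p => F p, hF.continuousOn.comp_continuous continuous_subtype_val fun p => hU p.2⟩,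
    mem_discAlgebra_of_differentiableOn (hF.mono (ball_subset_closedBall.trans hU)) fun _ => rfl⟩,
    fun _ => rfl⟩

end DiscAlgebra

section LetterSystem

variable {ι : Type*}

/-- Letters `a i` holomorphic on `D` and off `(0, ∞)`, of which `o` is zero and the others are
nowhere zero, with `∑ τ, m τ i j / (t - τ)` the logarithmic derivative of `a i - a j`. -/
structure LetterSystem (a : ι → ℂ → ℂ) (D : Set ℂ) (T : Finset ℂ) (m : ℂ → ι → ι → ℚ)
    (o : ι) : Prop where
  isOpen : IsOpen D
  differentiableOn : ∀ i, DifferentiableOn ℂ (a i) D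
  ne_pos : ∀ i, ∀ t ∈ D, ∀ x : ℝ, 0 < x → a i t ≠ x
  eq_zero : ∀ t ∈ D, a o t = 0
  ne_zero : ∀ i, i ≠ o → ∀ t ∈ D, a i t ≠ 0
  self_eq_zero : ∀ τ i, m τ i i = 0
  deriv_sub : ∀ i j, ∀ t ∈ D, deriv (a i) t - deriv (a j) t =
    (∑ τ ∈ T, (t - τ)⁻¹ * m τ i j) * (a i t - a j t)

namespace LetterSystem

variable {a : ι → ℂ → ℂ} {D : Set ℂ} {T : Finset ℂ} {m : ℂ → ι → ι → ℚ} {o : ι}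

theorem isLetterVariation (h : LetterSystem a D T m o) {t : ℂ} (ht : t ∈ D) :
    IsLetterVariation (fun i => a i t) (fun i => deriv (a i) t)
      (fun i j => ∑ τ ∈ T, (t - τ)⁻¹ * m τ i j) o where
  ne_pos i := h.ne_pos i t ht
  zero := h.eq_zero t ht
  deriv_zero := by
    have hzero : a o =ᶠ[𝓝 t] fun _ => 0 := eventually_of_mem (h.isOpen.mem_nhds ht) h.eq_zero
    rw [hzero.deriv_eq, deriv_const]
  deriv_sub i j := h.deriv_sub i j t ht
  logDeriv_eq_zero i hi := by
    obtain rfl : i = o := by_contra fun hio => h.ne_zero i hio t ht hi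
    simp [h.self_eq_zero]

theorem hasRegLimInf_hyperlog (h : LetterSystem a D T m o) (w : List ι) {t : ℂ} (ht : t ∈ D) :
    HasRegLimInf (hyperlog (w.map fun i => a i t)) (hyperlogReg (w.map fun i => a i t)) :=
  _root_.hasRegLimInf_hyperlog ((h.isLetterVariation ht).map_ne_pos w)

theorem exists_discAlgebra_letters (h : LetterSystem a D T m o) {t₀ : ℂ} {ρ : ℝ}
    (hρ : Metric.closedBall t₀ ρ ⊆ D) : ∃ b : ι → discAlgebra t₀ ρ,
      (∀ i p, discEval p (b i) = a i p) ∧ ∀ i, IsHyperlogLetter (b i) := by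
  choose b hb using fun i => exists_discAlgebra_of_differentiableOn (h.differentiableOn i) hρ
  refine ⟨b, hb, fun i => ⟨fun x hx => isUnit_discAlgebra fun p => ?_, ?_⟩⟩
  · have hsub : discEval p (algebraMap ℂ (discAlgebra t₀ ρ) x - b i) = x - a i p := by
      rw [map_sub, AlgHomClass.commutes, hb]
      rfl
    exact hsub.trans_ne (sub_ne_zero.2 (h.ne_pos i p (hρ p.2) x hx).symm)
  · by_cases hi : i = o
    · exact .inl (Subtype.ext (ContinuousMap.ext fun p =>
        (hb i p).trans (hi ▸ h.eq_zero p (hρ p.2))))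
    · exact .inr (isUnit_discAlgebra fun p => (hb i p).trans_ne (h.ne_zero i hi p (hρ p.2)))

theorem hasDerivAt_hyperlogReg (h : LetterSystem a D T m o) (w : List ι) {t₀ : ℂ} (ht₀ : t₀ ∈ D) :
    HasDerivAt (fun t => hyperlogReg (w.map fun i => a i t))
      (∑ τ ∈ T, (t₀ - τ)⁻¹ * Finsupp.linearCombination ℚ
        (fun u => hyperlogReg (u.map fun i => a i t₀)) (wordDeriv (m τ) o w)) t₀ := by
  obtain ⟨ρ, hρ, hD⟩ := Metric.nhds_basis_closedBall.mem_iff.1 (h.isOpen.mem_nhds ht₀)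
  obtain ⟨b, hb, hletter⟩ := h.exists_discAlgebra_letters hD
  have hletters : ∀ c ∈ w.map b, IsHyperlogLetter c := by
    simpa using fun i _ => hletter i
  obtain ⟨L, hL⟩ := exists_isHyperlog hletters
  obtain ⟨r, hr⟩ := hL.exists_hasRegLim_inv
  have hval (p : Metric.closedBall t₀ ρ) :
      discEval p r = hyperlogReg (w.map fun i => a i p) := by
    rw [hL.character_apply_reg (A := discAlgebra t₀ ρ) (discEval p) hletters hr, List.map_map]
    exact congrArg hyperlogReg (List.map_congr_left fun i _ => hb i p)
  have hχ : (fun i => discEval ⟨t₀, Metric.mem_closedBall_self hρ.le⟩ (b i)) = fun i => a i t₀ :=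
    funext fun i => hb i _
  have hδ : (fun i => discDeriv t₀ hρ (b i)) = fun i => deriv (a i) t₀ :=
    funext fun i => (hasDerivAt_discDeriv hρ (hb i)).deriv.symm
  have hderiv := (isPointDerivation_discDeriv t₀ hρ).apply_reg hletter
    (hχ ▸ hδ ▸ h.isLetterVariation ht₀) hL hr
  rw [hχ, linearCombination_wordDeriv_sum] at hderiv
  exact hderiv ▸ hasDerivAt_discDeriv hρ hval

end LetterSystem

end LetterSystem

section RegLimZero

variable {S V : Set ℂ}

theorem isPreconnected_cutPlane (hS : S.Finite) : IsPreconnected (cutPlane S) := by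
  obtain ⟨r, hr, hball⟩ :=
    Metric.nhdsWithin_basis_ball.eventually_iff.1 (eventually_mem_cutPlane hS)
  have hcenter : ((r / 2 : ℝ) : ℂ) ∈ Metric.ball (0 : ℂ) r := by
    rw [mem_ball_zero_iff, Complex.norm_real, Real.norm_of_nonneg (half_pos hr).le]
    exact half_lt_self hr
  set B : Set ℂ := Complex.slitPlane ∩ Metric.ball 0 r
  have hcenterB : ((r / 2 : ℝ) : ℂ) ∈ B :=
    ⟨Complex.ofReal_mem_slitPlane.2 (half_pos hr), hcenter⟩
  have hBstar : StarConvex ℝ ((r / 2 : ℝ) : ℂ) B :=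
    (Complex.starConvex_ofReal_slitPlane (half_pos hr)).inter
      ((convex_ball 0 r).starConvex hcenter)
  have hB : IsPreconnected B := (hBstar.isPathConnected hcenterB).isConnected.isPreconnected
  refine isPreconnected_of_forall ((r / 2 : ℝ) : ℂ) fun z hz => ?_
  obtain ⟨ε, hεB, hε0, hε1⟩ := (((tendsto_real_mul_slitPlane hz.1).eventually
    (Metric.nhdsWithin_basis_ball.mem_of_mem hr)).and (Ioo_mem_nhdsGT one_pos)).exists
  refine ⟨B ∪ (fun s : ℝ => (s : ℂ) * z) '' Set.Icc ε 1, ?_, .inl hcenterB,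
    .inr ⟨1, ⟨hε1.le, le_rfl⟩, by simp⟩, ?_⟩
  · rintro _ (h | ⟨s, hs, rfl⟩)
    · exact hball ⟨h.2, h.1⟩
    · exact real_mul_mem_cutPlane hz (hε0.trans_le hs.1) hs.2
  · have hsegment : IsPreconnected ((fun s : ℝ => (s : ℂ) * z) '' Set.Icc ε 1) :=
      isPreconnected_Icc.image _ (Complex.continuous_ofReal.mul continuous_const).continuousOn
    exact hB.union ((ε : ℂ) * z) ⟨hεB.2, hεB.1⟩ ⟨ε, ⟨le_rfl, hε1.le⟩, rfl⟩ hsegment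

theorem nhdsWithin_cutPlane_zero (hS : S.Finite) :
    𝓝[cutPlane S] (0 : ℂ) = 𝓝[Complex.slitPlane] 0 :=
  le_antisymm (nhdsWithin_mono 0 fun _ ht => ht.1)
    (le_inf nhdsWithin_le_nhds (le_principal_iff.2 (eventually_mem_cutPlane hS)))

theorem hasRegLimZero_iff (hS : S.Finite) {f : ℂ → ℂ} {c : ℂ} :
    HasRegLimZero (cutPlane S) V f c ↔ ∃ F v, DifferentiableOn ℂ F (cutPlane S) ∧
      Set.EqOn F f V ∧ HasLogExpansion F v ∧ v 0 = c := by
  simp only [HasRegLimZero, nhdsWithin_cutPlane_zero hS, ← exists_hasLogExpansion_iff,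
    exists_and_left]

theorem HasRegLimZero.congr {U : Set ℂ} {f f' : ℂ → ℂ} {c : ℂ} (h : HasRegLimZero U V f c)
    (hf : Set.EqOn f f' V) : HasRegLimZero U V f' c :=
  let ⟨F, hF, hFf, hexpansion⟩ := h
  ⟨F, hF, hFf.trans hf, hexpansion⟩

theorem HasRegLimZero.unique (hS : S.Finite) (hVo : IsOpen V) (hV : V.Nonempty)
    (hVU : V ⊆ cutPlane S) {f : ℂ → ℂ} {c c' : ℂ} (h : HasRegLimZero (cutPlane S) V f c)
    (h' : HasRegLimZero (cutPlane S) V f c') : c = c' := by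
  obtain ⟨F, v, hF, hFf, hv, rfl⟩ := (hasRegLimZero_iff hS).1 h
  obtain ⟨F', v', hF', hFf', hv', rfl⟩ := (hasRegLimZero_iff hS).1 h'
  obtain ⟨t, ht⟩ := hV
  have hU := isOpen_cutPlane hS
  have heq : Set.EqOn F F' (cutPlane S) :=
    (hF.analyticOnNhd hU).eqOn_of_preconnected_of_eventuallyEq (hF'.analyticOnNhd hU)
      (isPreconnected_cutPlane hS) (hVU ht)
      (eventually_of_mem (hVo.mem_nhds ht) (hFf.trans hFf'.symm))
  refine congrFun (hv.values_unique hv' ?_) 0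
  exact (tendsto_ofReal_nhdsGT_nhdsWithin_slitPlane.eventually
    (eventually_mem_cutPlane hS)).mono fun x hx => heq hx

end RegLimZero

section HyperlogSum

variable {S V : Set ℂ}

/-- A linear combination of hyperlogarithms over the alphabet `S`, as a function of `t`. -/
noncomputable def hyperlogSum (c : List S →₀ ℂ) (t : ℂ) : ℂ :=
  Finsupp.linearCombination ℂ (fun u : List S => hyperlog (u.map Subtype.val) t) c

theorem forall_mem_map_val {α : Type*} {s : Set α} (u : List s) :
    ∀ x ∈ u.map Subtype.val, x ∈ s := by
  intro x hx
  obtain ⟨y, -, rfl⟩ := List.mem_map.1 hx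
  exact y.2

theorem differentiableOn_hyperlogSum (hS : S.Finite) (c : List S →₀ ℂ) :
    DifferentiableOn ℂ (hyperlogSum c) (cutPlane S) :=
  .fun_sum fun u _ => (differentiableOn_hyperlog hS (forall_mem_map_val u)).const_smul (c u)

theorem hasLogExpansion_hyperlogSum (c : List S →₀ ℂ) : HasLogExpansion (hyperlogSum c)
    (Finsupp.linearCombination ℂ (fun u : List S => hyperlogValues (u.map Subtype.val)) c) :=
  HasLogExpansion.sum c.support fun u _ =>
    (hasLogExpansion_hyperlog (u.map Subtype.val)).const_smul (c u)

theorem linearCombination_hyperlogValues_apply_zero (c : List S →₀ ℂ) :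
    Finsupp.linearCombination ℂ (fun u : List S => hyperlogValues (u.map Subtype.val)) c 0 =
      c [] := by
  rw [Finsupp.linearCombination_apply, Finsupp.sum_apply', Finsupp.sum, Finset.sum_eq_single []]
  · simp [hyperlogValues]
  · intro u _ hu
    rw [Pi.smul_apply, hyperlogValues_apply_zero (List.map_eq_nil_iff.not.2 hu), smul_zero]
  · intro hu
    rw [Finsupp.notMem_support_iff.1 hu, zero_smul, Pi.zero_apply]

theorem hasRegLimZero_hyperlogSum (hS : S.Finite) (c : List S →₀ ℂ) :
    HasRegLimZero (cutPlane S) V (hyperlogSum c) (c []) :=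
  (hasRegLimZero_iff hS).2 ⟨_, _, differentiableOn_hyperlogSum hS c, fun _ _ => rfl,
    hasLogExpansion_hyperlogSum c, linearCombination_hyperlogValues_apply_zero c⟩

theorem hasDerivAt_hyperlogSum_mapDomain_cons (hS : S.Finite) (τ : S) (c : List S →₀ ℂ) {t : ℂ}
    (ht : t ∈ cutPlane S) :
    HasDerivAt (hyperlogSum (c.mapDomain (List.cons τ))) ((t - τ)⁻¹ * hyperlogSum c t) t := by
  have hcons (u : List S) : HasDerivAt (hyperlog ((τ :: u).map Subtype.val))
      ((t - τ)⁻¹ • hyperlog (u.map Subtype.val) t) t := by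
    rw [smul_eq_mul, inv_mul_eq_div]
    exact hasDerivAt_hyperlog_cons hS (forall_mem_map_val (τ :: u)) ht
  refine ((hasDerivAt_linearCombination hcons c).congr_deriv ?_).congr_of_eventuallyEq
    (.of_forall fun s => Finsupp.linearCombination_mapDomain ..)
  simp only [hyperlogSum, Finsupp.linearCombination_apply, Finsupp.sum, Finset.mul_sum,
    smul_eq_mul, mul_left_comm]

variable [Fintype S]

/-- The coefficients of the primitive with constant term `C` of `∑ τ, (t - τ)⁻¹ * f_τ(t)`,
where `f_τ` is the linear combination of hyperlogarithms with coefficients `c τ`. -/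
noncomputable def wordPrimitive (C : ℂ) (c : S → List S →₀ ℂ) : List S →₀ ℂ :=
  Finsupp.single [] C + ∑ τ, (c τ).mapDomain (List.cons τ)

theorem wordPrimitive_cons (C : ℂ) (c : S → List S →₀ ℂ) (τ : S) (u : List S) :
    wordPrimitive C c (τ :: u) = c τ u := by
  rw [wordPrimitive, Finsupp.add_apply, Finsupp.single_eq_of_ne (List.cons_ne_nil τ u), zero_add,
    Finsupp.finsetSum_apply, Finset.sum_eq_single τ]
  · exact Finsupp.mapDomain_apply List.cons_injective _ _
  · intro τ' _ hτ'
    refine Finsupp.mapDomain_of_notMem_range _ _ ?_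
    rintro ⟨u', hu'⟩
    exact hτ' (List.cons_eq_cons.1 hu').1
  · exact fun h => absurd (Finset.mem_univ τ) h

theorem hyperlogSum_wordPrimitive (C : ℂ) (c : S → List S →₀ ℂ) (t : ℂ) :
    hyperlogSum (wordPrimitive C c) t =
      C + ∑ τ, hyperlogSum ((c τ).mapDomain (List.cons τ)) t := by
  simp only [hyperlogSum, wordPrimitive, map_add, map_sum, Finsupp.linearCombination_single,
    List.map_nil, hyperlog, smul_eq_mul, mul_one]

theorem hasDerivAt_hyperlogSum_wordPrimitive (C : ℂ) (c : S → List S →₀ ℂ) {t : ℂ}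
    (ht : t ∈ cutPlane S) :
    HasDerivAt (hyperlogSum (wordPrimitive C c)) (∑ τ : S, (t - τ)⁻¹ * hyperlogSum (c τ) t) t :=
  ((HasDerivAt.fun_sum fun τ _ => hasDerivAt_hyperlogSum_mapDomain_cons S.toFinite τ (c τ)
    ht).const_add C).congr_of_eventuallyEq (.of_forall (hyperlogSum_wordPrimitive C c))

theorem exists_eqOn_hyperlogSum_wordPrimitive (hVo : IsOpen V) (hVc : IsPreconnected V)
    (hVU : V ⊆ cutPlane S) {f : ℂ → ℂ} (c : S → List S →₀ ℂ)
    (hf : ∀ t ∈ V, HasDerivAt f (∑ τ : S, (t - τ)⁻¹ * hyperlogSum (c τ) t) t) :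
    ∃ C, Set.EqOn f (hyperlogSum (wordPrimitive C c)) V := by
  have hprim (t : ℂ) (ht : t ∈ V) := hasDerivAt_hyperlogSum_wordPrimitive 0 c (hVU ht)
  obtain ⟨C, hC⟩ := hVo.exists_eq_add_of_deriv_eq hVc
    (fun t ht => (hf t ht).differentiableAt.differentiableWithinAt)
    (fun t ht => (hprim t ht).differentiableAt.differentiableWithinAt)
    fun t ht => (hf t ht).deriv.trans (hprim t ht).deriv.symm
  refine ⟨C, fun t ht => ?_⟩
  simp only [hC ht]
  rw [hyperlogSum_wordPrimitive, hyperlogSum_wordPrimitive, zero_add, add_comm]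

end HyperlogSum

section RegSum

variable {ι : Type*}

/-- The regularized limit at infinity of a linear combination of hyperlogarithms, as a function
of the parameter `t` of the letters. -/
noncomputable def regSum (a : ι → ℂ → ℂ) (w : List ι →₀ ℚ) (t : ℂ) : ℂ :=
  Finsupp.linearCombination ℚ (fun u => hyperlogReg (u.map fun i => a i t)) w

theorem length_lt_of_mem_support_linearCombination_wordDeriv {R : Type*} [Ring R]
    (m : ι → ι → R) (o : ι) {w : List ι →₀ R} {n : ℕ} (hw : ∀ u ∈ w.support, u.length < n + 1) :
    ∀ u ∈ (Finsupp.linearCombination R (wordDeriv m o) w).support, u.length < n := by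
  classical
  intro u hu
  obtain ⟨u', hu', hmem⟩ := Finsupp.mem_support_finsetSum u hu
  have hlength := length_of_mem_support_wordDeriv m o (Finsupp.support_smul hmem)
  have hbound := hw u' hu'
  omega

namespace LetterSystem

variable {a : ι → ℂ → ℂ} {D : Set ℂ} {m : ℂ → ι → ι → ℚ} {o : ι}

theorem hasDerivAt_regSum {T : Finset ℂ} (h : LetterSystem a D T m o) (w : List ι →₀ ℚ) {t : ℂ}
    (ht : t ∈ D) : HasDerivAt (regSum a w)
      (∑ τ ∈ T, (t - τ)⁻¹ * regSum a (Finsupp.linearCombination ℚ (wordDeriv (m τ) o) w) t) t := by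
  refine (hasDerivAt_linearCombination (fun u => h.hasDerivAt_hyperlogReg u ht) w).congr_deriv ?_
  simp only [regSum, Finsupp.linearCombination_linearCombination]
  simp only [Finsupp.linearCombination_apply ℚ w, Finsupp.sum, Finset.smul_sum, Finset.mul_sum,
    mul_smul_comm]
  exact Finset.sum_comm

theorem exists_eqOn_hyperlogSum {S V : Set ℂ} [Fintype S] (h : LetterSystem a D S.toFinset m o)
    (hDU : D ⊆ cutPlane S) (hVo : IsOpen V) (hVc : IsPreconnected V) (hVD : V ⊆ D) (n : ℕ)
    (w : List ι →₀ ℚ) (hw : ∀ u ∈ w.support, u.length < n) :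
    ∃ c : List S →₀ ℂ, (∀ u, ∃ v, HasRegLimZero (cutPlane S) V (regSum a v) (c u)) ∧
      Set.EqOn (regSum a w) (hyperlogSum c) V := by
  have hregLim {w : List ι →₀ ℚ} {c : List S →₀ ℂ} (hwc : Set.EqOn (regSum a w) (hyperlogSum c) V) :
      ∃ v, HasRegLimZero (cutPlane S) V (regSum a v) (c []) :=
    ⟨w, (hasRegLimZero_hyperlogSum S.toFinite c).congr hwc.symm⟩
  induction n generalizing w with
  | zero =>
    have hw0 : w = 0 := Finsupp.support_eq_empty.1
      (Finset.eq_empty_of_forall_notMem fun u hu => (Nat.not_lt_zero _ (hw u hu)).elim)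
    have heq : Set.EqOn (regSum a w) (hyperlogSum (0 : List S →₀ ℂ)) V := fun t _ => by
      rw [hw0, regSum, hyperlogSum, map_zero, map_zero]
    exact ⟨0, fun _ => hregLim heq, heq⟩
  | succ n ih =>
    choose c hc hceq using fun τ : S =>
      ih _ (length_lt_of_mem_support_linearCombination_wordDeriv (m τ) o hw)
    obtain ⟨C, hC⟩ := exists_eqOn_hyperlogSum_wordPrimitive hVo hVc (hVD.trans hDU) c
      fun t ht => (h.hasDerivAt_regSum w (hVD ht)).congr_deriv <| by
        rw [Finset.sum_subtype S.toFinset (p := (· ∈ S)) (by simp)]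
        exact Finset.sum_congr rfl fun τ _ => by rw [hceq τ ht]
    refine ⟨wordPrimitive C c, fun u => ?_, hC⟩
    cases u with
    | nil => exact hregLim hC
    | cons τ u => exact wordPrimitive_cons C c τ u ▸ hc τ u

end LetterSystem

end RegSum

section RationalFunctions

open Polynomial

theorem differentiableAt_letterAt {r : RatFunc ℚ} {t : ℂ} (h : aeval t r.denom ≠ 0) :
    DifferentiableAt ℂ (letterAt r) t :=
  (Polynomial.differentiable_aeval _ t).div (Polynomial.differentiable_aeval _ t) h

theorem letterAt_zero (t : ℂ) : letterAt 0 t = 0 := RatFunc.eval_zero _ _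

theorem letterAt_sub {r s : RatFunc ℚ} {t : ℂ} (hr : aeval t r.denom ≠ 0)
    (hs : aeval t s.denom ≠ 0) : letterAt (r - s) t = letterAt r t - letterAt s t := by
  have hC : eval₂ (algebraMap ℚ ℂ) t (RatFunc.C (-1 : ℚ)).denom ≠ 0 := by
    rw [RatFunc.denom_C, eval₂_one]
    exact one_ne_zero
  have hneg : eval₂ (algebraMap ℚ ℂ) t (RatFunc.C (-1) * s).denom ≠ 0 := fun h => by
    have hmul := eval₂_eq_zero_of_dvd_of_eval₂_eq_zero _ t (RatFunc.denom_mul_dvd _ s) h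
    rw [eval₂_mul] at hmul
    exact (mul_ne_zero hC hs) hmul
  have hsub : r - s = r + RatFunc.C (-1) * s := by
    rw [map_neg, map_one, neg_one_mul, sub_eq_add_neg]
  rw [letterAt, hsub, RatFunc.eval_add (algebraMap ℚ ℂ) t hr hneg,
    RatFunc.eval_mul (algebraMap ℚ ℂ) t hC hs, RatFunc.eval_C, map_neg, map_one, neg_one_mul,
    ← sub_eq_add_neg]
  rfl

theorem sum_map_roots_eq {K : Type*} [Field K] {p : K[X]} {T : Finset K}
    (hT : ∀ x ∈ p.roots, x ∈ T) (f : K → K) :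
    (p.roots.map f).sum = ∑ x ∈ T, f x * p.rootMultiplicity x := by
  classical
  rw [Finset.sum_multiset_map_count]
  simp only [count_roots, nsmul_eq_mul, mul_comm (_ : K) (f _)]
  refine Finset.sum_subset (fun x hx => hT x (Multiset.mem_toFinset.1 hx)) fun x _ hx => ?_
  rw [← count_roots, Multiset.count_eq_zero_of_notMem (Multiset.mem_toFinset.not.1 hx),
    Nat.cast_zero, mul_zero]

theorem logDeriv_aeval {p : ℚ[X]} {t : ℂ} (ht : aeval t p ≠ 0) {T : Finset ℂ}
    (hT : ∀ τ, aeval τ p = 0 → τ ∈ T) :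
    logDeriv (fun t => aeval t p) t =
      ∑ τ ∈ T, (t - τ)⁻¹ * (p.map (algebraMap ℚ ℂ)).rootMultiplicity τ := by
  have hsum := (IsAlgClosed.splits (p.map (algebraMap ℚ ℂ))).eval_derivative_div_eval_of_ne_zero
    (x := t) (by rwa [eval_map_algebraMap])
  rw [derivative_map, eval_map_algebraMap, eval_map_algebraMap] at hsum
  rw [logDeriv_apply, Polynomial.deriv_aeval, hsum, sum_map_roots_eq (T := T)]
  · simp only [one_div]
  · intro τ hτ
    exact hT τ (eval_map_algebraMap p τ ▸ (mem_roots'.1 hτ).2)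

/-- The order of the rational function `r` at `τ`, negative at a pole. -/
noncomputable def orderAt (r : RatFunc ℚ) (τ : ℂ) : ℚ :=
  ((r.num.map (algebraMap ℚ ℂ)).rootMultiplicity τ : ℚ) -
    (r.denom.map (algebraMap ℚ ℂ)).rootMultiplicity τ

theorem orderAt_zero (τ : ℂ) : orderAt 0 τ = 0 := by
  simp [orderAt]

theorem logDeriv_letterAt {r : RatFunc ℚ} {t : ℂ} (hn : aeval t r.num ≠ 0)
    (hd : aeval t r.denom ≠ 0) {T : Finset ℂ}
    (hT : ∀ τ, aeval τ r.num = 0 ∨ aeval τ r.denom = 0 → τ ∈ T) :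
    logDeriv (letterAt r) t = ∑ τ ∈ T, (t - τ)⁻¹ * orderAt r τ := by
  have hdiv : logDeriv (letterAt r) t =
      logDeriv (fun t => aeval t r.num) t - logDeriv (fun t => aeval t r.denom) t :=
    logDeriv_div t hn hd (Polynomial.differentiable_aeval _ t) (Polynomial.differentiable_aeval _ t)
  rw [hdiv, logDeriv_aeval hn fun τ h => hT τ (.inl h),
    logDeriv_aeval hd fun τ h => hT τ (.inr h), ← Finset.sum_sub_distrib]
  refine Finset.sum_congr rfl fun τ _ => ?_
  rw [orderAt, Rat.cast_sub, Rat.cast_natCast, Rat.cast_natCast, mul_sub]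

theorem eq_C_mul_of_map_eq_C_mul_map {K L : Type*} [Field K] [Field L] [Algebra K L] {p q : K[X]}
    (hq : q.Monic) {c : L} (h : p.map (algebraMap K L) = C c * q.map (algebraMap K L)) :
    algebraMap K L (p.coeff q.natDegree) = c ∧ p = C (p.coeff q.natDegree) * q := by
  have hc : algebraMap K L (p.coeff q.natDegree) = c := by
    rw [← coeff_map, h, coeff_C_mul, coeff_map, hq.coeff_natDegree, map_one, mul_one]
  refine ⟨hc, map_injective (algebraMap K L) (algebraMap K L).injective ?_⟩
  rw [h, Polynomial.map_mul, map_C, hc]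

theorem eq_C_of_eventually_letterAt_eq {r : RatFunc ℚ} {t c : ℂ} (hd : aeval t r.denom ≠ 0)
    (h : ∀ᶠ s in 𝓝 t, letterAt r s = c) : ∃ q : ℚ, r = RatFunc.C q ∧ (q : ℂ) = c := by
  have hd' : ∀ᶠ s in 𝓝 t, aeval s r.denom ≠ 0 :=
    (Polynomial.differentiable_aeval r.denom t).continuousAt.eventually_ne hd
  have hmap : r.num.map (algebraMap ℚ ℂ) = C c * r.denom.map (algebraMap ℚ ℂ) := by
    refine eq_of_infinite_eval_eq _ _ ((infinite_of_mem_nhds t (h.and hd')).mono ?_)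
    rintro s ⟨hs, hs'⟩
    have hnum : aeval s r.num = c * aeval s r.denom := (div_eq_iff hs').1 hs
    simpa [eval_map_algebraMap] using hnum
  obtain ⟨hc, hnum⟩ := eq_C_mul_of_map_eq_C_mul_map r.monic_denom hmap
  refine ⟨_, ?_, hc⟩
  rw [← RatFunc.algebraMap_C, eq_div_of_mul_eq (RatFunc.algebraMap_ne_zero r.denom_ne_zero)
    ((map_mul _ _ _).symm.trans (congrArg _ hnum.symm)), RatFunc.num_div_denom]

end RationalFunctions

section RationalLetters

open Polynomial

variable {A : Finset (RatFunc ℚ)}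

theorem finite_zeroPoleSet (A : Finset (RatFunc ℚ)) : (zeroPoleSet A).Finite := by
  have hsub : zeroPoleSet A ⊆ ⋃ σ ∈ A, ⋃ ρ ∈ A,
      ((σ - ρ).num.rootSet ℂ ∪ (σ - ρ).denom.rootSet ℂ) := by
    rintro τ ⟨σ, hσ, ρ, hρ, hne, h⟩
    refine Set.mem_biUnion hσ (Set.mem_biUnion hρ ?_)
    exact h.imp (fun h => mem_rootSet.2 ⟨RatFunc.num_ne_zero (sub_ne_zero.2 hne), h⟩)
      fun h => mem_rootSet.2 ⟨RatFunc.denom_ne_zero _, h⟩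
  exact .subset (A.finite_toSet.biUnion fun σ _ => A.finite_toSet.biUnion fun ρ _ =>
    (rootSet_finite _ _).union (rootSet_finite _ _)) hsub

theorem isAlgebraic_of_mem_zeroPoleSet {τ : ℂ} (h : τ ∈ zeroPoleSet A) : IsAlgebraic ℚ τ := by
  obtain ⟨σ, -, ρ, -, hne, h | h⟩ := h
  · exact ⟨_, RatFunc.num_ne_zero (sub_ne_zero.2 hne), h⟩
  · exact ⟨_, RatFunc.denom_ne_zero _, h⟩

theorem aeval_sub_ne_zero {σ ρ : RatFunc ℚ} (hσ : σ ∈ A) (hρ : ρ ∈ A) (hne : σ ≠ ρ) {t : ℂ}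
    (ht : t ∈ cutPlane (zeroPoleSet A)) :
    aeval t (σ - ρ).num ≠ 0 ∧ aeval t (σ - ρ).denom ≠ 0 :=
  ⟨fun h => ne_of_mem_cutPlane ht ⟨σ, hσ, ρ, hρ, hne, .inl h⟩ rfl,
    fun h => ne_of_mem_cutPlane ht ⟨σ, hσ, ρ, hρ, hne, .inr h⟩ rfl⟩

theorem aeval_denom_ne_zero (h0 : (0 : RatFunc ℚ) ∈ A) {σ : RatFunc ℚ} (hσ : σ ∈ A) {t : ℂ}
    (ht : t ∈ cutPlane (zeroPoleSet A)) : aeval t σ.denom ≠ 0 := by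
  by_cases h : σ = 0
  · simp [h]
  · simpa only [sub_zero] using (aeval_sub_ne_zero hσ h0 h ht).2

theorem letterAt_ne_zero (h0 : (0 : RatFunc ℚ) ∈ A) {σ : RatFunc ℚ} (hσ : σ ∈ A) (h : σ ≠ 0)
    {t : ℂ} (ht : t ∈ cutPlane (zeroPoleSet A)) : letterAt σ t ≠ 0 := by
  have hnd := aeval_sub_ne_zero hσ h0 h ht
  rw [sub_zero] at hnd
  exact div_ne_zero hnd.1 hnd.2

theorem differentiableOn_letterAt (h0 : (0 : RatFunc ℚ) ∈ A) {σ : RatFunc ℚ} (hσ : σ ∈ A) :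
    DifferentiableOn ℂ (letterAt σ) (cutPlane (zeroPoleSet A)) := fun _ ht =>
  (differentiableAt_letterAt (aeval_denom_ne_zero h0 hσ ht)).differentiableWithinAt

theorem deriv_letterAt_sub_deriv_letterAt [Fintype (zeroPoleSet A)] (h0 : (0 : RatFunc ℚ) ∈ A)
    {σ ρ : RatFunc ℚ} (hσ : σ ∈ A) (hρ : ρ ∈ A) {t : ℂ} (ht : t ∈ cutPlane (zeroPoleSet A)) :
    deriv (letterAt σ) t - deriv (letterAt ρ) t =
      (∑ τ ∈ (zeroPoleSet A).toFinset, (t - τ)⁻¹ * orderAt (σ - ρ) τ) *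
        (letterAt σ t - letterAt ρ t) := by
  by_cases hne : σ = ρ
  · rw [hne, sub_self, sub_self (letterAt ρ t), mul_zero]
  have hU := (isOpen_cutPlane (finite_zeroPoleSet A)).mem_nhds ht
  have hsub (s : ℂ) (hs : s ∈ cutPlane (zeroPoleSet A)) :
      letterAt (σ - ρ) s = letterAt σ s - letterAt ρ s :=
    letterAt_sub (aeval_denom_ne_zero h0 hσ hs) (aeval_denom_ne_zero h0 hρ hs)
  have heq : letterAt (σ - ρ) =ᶠ[𝓝 t] fun s => letterAt σ s - letterAt ρ s :=
    eventually_of_mem hU hsub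
  have hT (τ : ℂ) (h : aeval τ (σ - ρ).num = 0 ∨ aeval τ (σ - ρ).denom = 0) :
      τ ∈ (zeroPoleSet A).toFinset := Set.mem_toFinset.2 ⟨σ, hσ, ρ, hρ, hne, h⟩
  obtain ⟨hn, hd⟩ := aeval_sub_ne_zero hσ hρ hne ht
  rw [← deriv_fun_sub ((differentiableOn_letterAt h0 hσ).differentiableAt hU)
      ((differentiableOn_letterAt h0 hρ).differentiableAt hU),
    ← heq.deriv_eq, ← hsub t ht,
    ← logDeriv_letterAt hn hd hT,
    logDeriv_apply, div_mul_cancel₀]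
  exact div_ne_zero hn hd

theorem letterSystem [Fintype (zeroPoleSet A)] (h0 : (0 : RatFunc ℚ) ∈ A)
    (hopen : IsOpen (paramDomain A)) :
    LetterSystem (fun (i : A) t => letterAt i t) (paramDomain A)
      (zeroPoleSet A).toFinset (fun τ i j => orderAt (i.1 - j.1) τ) ⟨0, h0⟩ where
  isOpen := hopen
  differentiableOn i := (differentiableOn_letterAt h0 i.2).mono fun _ ht => ht.1
  ne_pos i t ht := ht.2 i.1 i.2
  eq_zero t _ := letterAt_zero t
  ne_zero i hi t ht := letterAt_ne_zero h0 i.2 (fun h => hi (Subtype.ext h)) ht.1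
  self_eq_zero τ i := by rw [sub_self, orderAt_zero]
  deriv_sub i j t ht := deriv_letterAt_sub_deriv_letterAt h0 i.2 j.2 ht.1

end RationalLetters

section Density

theorem dense_compl_range_smul (τ : ℂ) : Dense (Set.range fun r : ℝ => r • τ)ᶜ :=
  ContDiff.dense_compl_range_of_finrank_lt_finrank (contDiff_id.smul contDiff_const)
    (by rw [Module.finrank_self, Complex.finrank_real_complex]; exact one_lt_two)

theorem isClosed_range_smul (τ : ℂ) : IsClosed (Set.range fun r : ℝ => r • τ) :=
  Set.image_univ ▸ isClosedMap_smul_left τ _ isClosed_univ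

theorem dense_cutPlane {S : Set ℂ} (hS : S.Finite) : Dense (cutPlane S) := by
  have hlines : Dense (⋂ τ ∈ insert 1 S, (Set.range fun r : ℝ => r • τ)ᶜ) :=
    dense_biInter_of_isOpen (fun τ _ => (isClosed_range_smul τ).isOpen_compl)
      (hS.insert 1).countable fun τ _ => dense_compl_range_smul τ
  refine hlines.mono fun z hz => ?_
  rw [Set.mem_iInter₂] at hz
  refine ⟨Complex.mem_slitPlane_iff.2 (.inr fun him => hz 1 (Set.mem_insert 1 S) ⟨z.re, ?_⟩),
    fun τ hτ r _ h => hz τ (Set.mem_insert_of_mem 1 hτ) ⟨r, h.symm⟩⟩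
  exact Complex.ext (by simp) (by simp [him])

theorem eventually_eq_of_eventually_im_eq_zero {f : ℂ → ℂ} {t : ℂ} (hf : AnalyticAt ℂ f t)
    (him : ∀ᶠ s in 𝓝 t, (f s).im = 0) : ∃ c, ∀ᶠ s in 𝓝 t, f s = c := by
  obtain ⟨ε, hε, hball⟩ := Metric.eventually_nhds_iff_ball.1 (hf.eventually_analyticAt.and him)
  obtain ⟨c, hc⟩ := AnalyticOnNhd.eq_const_of_im_eq_const (fun s hs => (hball s hs).1)
    (fun s hs => (hball s hs).2) Metric.isOpen_ball (Metric.isConnected_ball hε)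
  exact ⟨c, eventually_of_mem (Metric.ball_mem_nhds t hε) hc⟩

/-- The part of the cut plane where the letter `σ` takes no value in `(0, ∞)`. -/
def letterDomain (A : Finset (RatFunc ℚ)) (σ : RatFunc ℚ) : Set ℂ :=
  {t | t ∈ cutPlane (zeroPoleSet A) ∧ ∀ x : ℝ, 0 < x → letterAt σ t ≠ x}

variable {A : Finset (RatFunc ℚ)}

theorem letterDomain_zero : letterDomain A 0 = cutPlane (zeroPoleSet A) := by
  ext t
  refine and_iff_left fun x hx h => ?_
  rw [letterAt_zero] at h
  exact hx.ne (by exact_mod_cast h)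

theorem isOpen_letterDomain (h0 : (0 : RatFunc ℚ) ∈ A) {σ : RatFunc ℚ} (hσ : σ ∈ A) :
    IsOpen (letterDomain A σ) := by
  have hU := isOpen_cutPlane (finite_zeroPoleSet A)
  by_cases h : σ = 0
  · rwa [h, letterDomain_zero]
  have hclosed : IsClosed (Complex.ofReal '' Set.Ici 0) :=
    Complex.isometry_ofReal.isClosedEmbedding.isClosedMap _ isClosed_Ici
  have heq : letterDomain A σ =
      cutPlane (zeroPoleSet A) ∩ letterAt σ ⁻¹' (Complex.ofReal '' Set.Ici 0)ᶜ := by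
    ext t
    refine and_congr_right fun ht => ⟨?_, fun hnot x hx heq => hnot ⟨x, hx.le, heq.symm⟩⟩
    rintro hpos ⟨x, hx, heq⟩
    refine hpos x (hx.lt_of_ne ?_) heq.symm
    rintro rfl
    exact letterAt_ne_zero h0 hσ h ht heq.symm
  rw [heq]
  exact (differentiableOn_letterAt h0 hσ).continuousOn.isOpen_inter_preimage hU
    hclosed.isOpen_compl

theorem dense_letterDomain (h0 : (0 : RatFunc ℚ) ∈ A)
    (hpos : ∀ q : ℚ, 0 < q → RatFunc.C q ∉ A) {σ : RatFunc ℚ} (hσ : σ ∈ A) :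
    Dense (letterDomain A σ) := by
  have hU := isOpen_cutPlane (finite_zeroPoleSet A)
  refine Dense.of_closure ((dense_cutPlane (finite_zeroPoleSet A)).mono fun t ht => ?_)
  rw [mem_closure_iff_frequently]
  intro hnot
  have hval : ∀ᶠ s in 𝓝 t, ∃ x : ℝ, 0 < x ∧ letterAt σ s = x := by
    filter_upwards [hnot, hU.mem_nhds ht] with s hs hsU
    by_contra! hx
    exact hs ⟨hsU, hx⟩
  obtain ⟨c, hc⟩ := eventually_eq_of_eventually_im_eq_zero
    ((differentiableOn_letterAt h0 hσ).analyticAt (hU.mem_nhds ht))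
    (hval.mono fun s ⟨x, _, hx⟩ => by rw [hx, Complex.ofReal_im])
  obtain ⟨q, rfl, hq⟩ := eq_C_of_eventually_letterAt_eq (aeval_denom_ne_zero h0 hσ ht) hc
  obtain ⟨x, hx, hxc⟩ := hval.self_of_nhds
  rw [hc.self_of_nhds, ← hq] at hxc
  have hqx : (q : ℝ) = x := by exact_mod_cast hxc
  exact hpos q (by exact_mod_cast hqx ▸ hx) hσ

theorem paramDomain_eq_iInter_letterDomain (h0 : (0 : RatFunc ℚ) ∈ A) :
    paramDomain A = ⋂ σ ∈ A, letterDomain A σ := by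
  ext t
  rw [Set.mem_iInter₂]
  exact ⟨fun h σ hσ => ⟨h.1, h.2 σ hσ⟩, fun h => ⟨(h 0 h0).1, fun σ hσ => (h σ hσ).2⟩⟩

theorem isOpen_paramDomain (h0 : (0 : RatFunc ℚ) ∈ A) : IsOpen (paramDomain A) := by
  rw [paramDomain_eq_iInter_letterDomain h0]
  exact isOpen_biInter_finset fun σ hσ => isOpen_letterDomain h0 hσ

theorem dense_paramDomain (h0 : (0 : RatFunc ℚ) ∈ A)
    (hpos : ∀ q : ℚ, 0 < q → RatFunc.C q ∉ A) : Dense (paramDomain A) := by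
  rw [paramDomain_eq_iInter_letterDomain h0]
  exact dense_biInter_of_isOpen (S := (A : Set (RatFunc ℚ)))
    (fun σ hσ => isOpen_letterDomain h0 hσ) A.countable_toSet
    fun σ hσ => dense_letterDomain h0 hpos hσ

end Density

section Regularization

variable {A : Finset (RatFunc ℚ)}

theorem hasRegLimInf_hyperlogAt (h0 : (0 : RatFunc ℚ) ∈ A) (w : WordSpace A) {t : ℂ}
    (ht : t ∈ paramDomain A) :
    HasRegLimInf (hyperlogAt w t) (regSum (fun (σ : A) t => letterAt σ t) w t) := by
  let := (finite_zeroPoleSet A).fintype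
  have hword (u : List A) :=
    hasRegLimInf_iff.1 ((letterSystem h0 (isOpen_paramDomain h0)).hasRegLimInf_hyperlog u ht)
  refine hasRegLimInf_iff.2 ((HasRegLim.linearCombination hword w).congr (.of_forall fun y => ?_))
  simp only [hyperlogAt, Finsupp.linearCombination_apply, Rat.smul_def]

theorem regHyperlog_eq_regSum (h0 : (0 : RatFunc ℚ) ∈ A) (w : WordSpace A) {t : ℂ}
    (ht : t ∈ paramDomain A) :
    regHyperlog w t = regSum (fun (σ : A) t => letterAt σ t) w t :=
  (hasRegLimInf_hyperlogAt h0 w ht).regLimInf_eq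

end Regularization

theorem mainTheorem5 (A : Finset (RatFunc ℚ)) (h0 : (0 : RatFunc ℚ) ∈ A)
    (hpos : ∀ q : ℚ, 0 < q → RatFunc.C q ∉ A) :
    (zeroPoleSet A).Finite ∧ (∀ τ ∈ zeroPoleSet A, IsAlgebraic ℚ τ) ∧
    IsOpen (paramDomain A) ∧ Dense (paramDomain A) ∧
    (∀ w : WordSpace A, ∀ t ∈ paramDomain A, ∃! c : ℂ, HasRegLimInf (hyperlogAt w t) c) ∧
    ∀ V : Set ℂ, IsOpen V → IsConnected V → V ⊆ paramDomain A →
      ∀ w : WordSpace A,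
        (∃! c : ℂ, HasRegLimZero (cutPlane (zeroPoleSet A)) V (regHyperlog w) c) ∧
        ∃ c : List (zeroPoleSet A) →₀ ℂ,
          (∀ u, ∃ v : WordSpace A,
            HasRegLimZero (cutPlane (zeroPoleSet A)) V (regHyperlog v) (c u)) ∧
          ∀ t ∈ V, regHyperlog w t =
            c.sum fun u a => a * hyperlog (u.map Subtype.val) t := by
  have hS := finite_zeroPoleSet A
  have hD := isOpen_paramDomain h0
  refine ⟨hS, fun τ hτ => isAlgebraic_of_mem_zeroPoleSet hτ, hD, dense_paramDomain h0 hpos,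
    fun w t ht => ⟨_, hasRegLimInf_hyperlogAt h0 w ht,
      fun c hc => hc.unique (hasRegLimInf_hyperlogAt h0 w ht)⟩, fun V hVo hVc hVD w => ?_⟩
  have hDU : paramDomain A ⊆ cutPlane (zeroPoleSet A) := fun t ht => ht.1
  let := hS.fintype
  obtain ⟨c, hc, hwc⟩ := (letterSystem h0 hD).exists_eqOn_hyperlogSum hDU hVo hVc.isPreconnected
    hVD (w.support.sup List.length + 1) w
    fun u hu => Nat.lt_succ_of_le (Finset.le_sup (f := List.length) hu)
  have hR (v : WordSpace A) :
      Set.EqOn (regSum (fun (σ : A) t => letterAt σ t) v) (regHyperlog v) V :=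
    fun t ht => (regHyperlog_eq_regSum h0 v (hVD ht)).symm
  have hreg : HasRegLimZero (cutPlane (zeroPoleSet A)) V (regHyperlog w) (c []) :=
    (hasRegLimZero_hyperlogSum hS c).congr (hwc.symm.trans (hR w))
  exact ⟨⟨c [], hreg, fun c' hc' => hc'.unique hS hVo hVc.nonempty (hVD.trans hDU) hreg⟩,
    c, fun u => (hc u).imp fun v hv => hv.congr (hR v), (hR w).symm.trans hwc⟩
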